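/- Let $R$ be a commutative ring. For $R$-complexes $T$ and $A$ (with differentials of degree $-1$), an $R$-module $X$ and $n\in\mathbb{Z}$, write $C_0(T)=\operatorname{Coker}(T_1\to T_0)$; let $T_{\geq 0}$ and $T_{\leq -1}$ be the hard truncations of $T$; and let $\Sigma$ be the shift, with $(\Sigma A)_i=A_{i-1}$ and $\partial^{\Sigma A}=-\partial^A$. A complex $T$ of projective $R$-modules is totally acyclic if $T$ is acyclic and $\operatorname{Hom}_R(T,Q)$ is acyclic for every projective $R$-module $Q$. An $R$-module $G$ is Gorenstein projective if there is a totally acyclic complex $T$ of projective $R$-modules with $C_0(T)\cong G$; any such $T$ is called a complete projective resolution of $G$. For a Gorenstein projective $R$-module $M$ with complete projective resolution $S$, put $$\widehat{\operatorname{Tor}}^R_i(M,X)=H_i(S\otimes_R X)\quad\text{and}\quad \widehat{\operatorname{Ext}}_R^i(M,X)=H_{-i}(\operatorname{Hom}_R(S,X))\qquad (i\in\mathbb{Z});$$ up to isomorphism these modules do not depend on the choice of $S$. The pinched tensor product $T\boxtimes_R A$ is the complex with $$(T\boxtimes_R A)_n=\begin{cases}(T_{\geq 0}\otimes_R A_{\geq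 0})_n & n\ge 0,\\ (T_{\leq -1}\otimes_R\Sigma(A_{\leq -1}))_n & n\le -1,\end{cases}$$ whose differential is that of $T_{\geq 0}\otimes_R A_{\geq 0}$ in degrees $n\ge 1$, that of $T_{\leq -1}\otimes_R\Sigma(A_{\leq -1})$ in degrees $n\le -1$, and the map $T_0\otimes_R A_0\to T_{-1}\otimes_R A_{-1}$, $x\otimes y\mapsto \partial^T(x)\otimes\partial^A(y)$, in degree $0$. Let $M$ and $N$ be Gorenstein projective $R$-modules with complete projective resolutions $T$ and $T'$, respectively. If $\widehat{\operatorname{Tor}}^R_i(M,N)=0$ for all $i\in\mathbb{Z}$, then $T\boxtimes_R T'$ is an acyclic complex of projective $R$-modules, and the following conditions are equivalent: (i) the complex $T\boxtimes_R T'$ is totally acyclic; (ii) for every projective $R$-module $Q$ one has $\widehat{\operatorname{Ext}}_R^i(M,\operatorname{Hom}_R(N,Q))=0$ for all $i\in\mathbb{Z}$. When these conditions hold, the $R$-module $M\otimes_R N$ is Gorenstein projective with complete projective resolution $T\boxtimes_R T'$. -/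

import Mathlib

open CategoryTheory
open scoped TensorProduct DirectSum

universe u

noncomputable section

namespace PinchedTensor

variable {R : Type u} [CommRing R]

theorem d_d_apply (T : ChainComplex (ModuleCat.{u} R) ℤ) (i j k : ℤ) (x : T.X i) :
    (T.d j k).hom ((T.d i j).hom x) = 0 := by
  rw [← LinearMap.comp_apply, ← ModuleCat.hom_comp, T.d_comp_d]
  rfl

/-- The complex `T ⊗ N`, for an `R`-complex `T` and an `R`-module `N`. -/
def tensorModule (T : ChainComplex (ModuleCat.{u} R) ℤ) (N : Type u) [AddCommGroup N] [Module R N] :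
    ChainComplex (ModuleCat.{u} R) ℤ where
  X n := ModuleCat.of R (T.X n ⊗[R] N)
  d n m := ModuleCat.ofHom ((T.d n m).hom.rTensor N)
  shape n m h := by
    ext : 1
    simp [T.shape n m h]
  d_comp_d' n m l _ _ := by
    ext : 1
    have h : (T.d m l).hom ∘ₗ (T.d n m).hom = 0 := by
      rw [← ModuleCat.hom_comp, T.d_comp_d]; rfl
    simp only [ModuleCat.hom_comp, ModuleCat.hom_ofHom, ModuleCat.hom_zero]
    rw [← LinearMap.rTensor_comp, h, LinearMap.rTensor_zero]

/-- The complex `Hom(T, Q)`, for an `R`-complex `T` and an `R`-module `Q`: its module in degree `n`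
is `Hom(T₋ₙ, Q)`, and its differential maps `φ` of degree `n` to `-(-1)ⁿ φ ∘ d`. -/
def homModule (T : ChainComplex (ModuleCat.{u} R) ℤ) (Q : Type u) [AddCommGroup Q] [Module R Q] :
    ChainComplex (ModuleCat.{u} R) ℤ where
  X n := ModuleCat.of R (T.X (-n) →ₗ[R] Q)
  d n m := ModuleCat.ofHom (-(n.negOnePow • LinearMap.lcomp R Q (T.d (-m) (-n)).hom))
  shape n m h := by
    have h' : ¬ (ComplexShape.down ℤ).Rel (-m) (-n) := by
      simp only [ComplexShape.down_Rel] at h ⊢; lia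
    ext φ x
    simp [T.shape _ _ h']
  d_comp_d' n m l _ _ := by
    ext φ x
    simp [Units.smul_def, d_d_apply]

/-- A totally acyclic complex of projective modules: an acyclic complex `T` of projective
`R`-modules such that `Hom(T, Q)` is acyclic for every projective `R`-module `Q`. -/
structure IsTotallyAcyclic (T : ChainComplex (ModuleCat.{u} R) ℤ) : Prop where
  projective (n : ℤ) : Module.Projective R (T.X n)
  acyclic : T.Acyclic
  hom_acyclic (Q : Type u) [AddCommGroup Q] [Module R Q] [Module.Projective R Q] :
    (homModule T Q).Acyclic

/-- `T` is a complete projective resolution of the module `G`: it is a totally acyclic complex of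
projective modules with `Coker (d : T₁ → T₀) ≅ G`. -/
structure IsCompleteResolution (T : ChainComplex (ModuleCat.{u} R) ℤ)
    (G : Type u) [AddCommGroup G] [Module R G] : Prop where
  totallyAcyclic : IsTotallyAcyclic T
  coker : Nonempty ((T.X 0 ⧸ LinearMap.range (T.d 1 0).hom) ≃ₗ[R] G)

variable (R) in
/-- Gorenstein projective modules. -/
def IsGorensteinProjective (G : Type u) [AddCommGroup G] [Module R G] : Prop :=
  ∃ T : ChainComplex (ModuleCat.{u} R) ℤ, IsCompleteResolution T G

/-- The Tate homology in degree `i`, with coefficients in `N`, of a module with complete projective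
resolution `S`. -/
def tateTor (S : ChainComplex (ModuleCat.{u} R) ℤ) (N : Type u) [AddCommGroup N] [Module R N]
    (i : ℤ) : ModuleCat.{u} R :=
  (tensorModule S N).homology i

/-- The Tate cohomology in degree `i`, with coefficients in `N`, of a module with complete
projective resolution `S`. -/
def tateExt (S : ChainComplex (ModuleCat.{u} R) ℤ) (N : Type u) [AddCommGroup N] [Module R N]
    (i : ℤ) : ModuleCat.{u} R :=
  (homModule S N).homology (-i)

/-- The pairs `(i, j)` for which `Tᵢ ⊗ Aⱼ` is a summand of the pinched tensor product in degree
`n`. For `n ≥ 0` these are the pairs with `i, j ≥ 0` and `i + j = n`; for `n ≤ -1` they are the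
pairs with `i, j ≤ -1` and `i + (j + 1) = n`, as `Aⱼ` has degree `j + 1` in the shift of `A`. -/
def pinchedIndex (n : ℤ) : Set (ℤ × ℤ) :=
  {p | (0 ≤ n ∧ 0 ≤ p.1 ∧ 0 ≤ p.2 ∧ p.1 + p.2 = n) ∨
    (n ≤ -1 ∧ p.1 ≤ -1 ∧ p.2 ≤ -1 ∧ p.1 + (p.2 + 1) = n)}

/-- The module of the pinched tensor product in degree `n`. -/
abbrev PinchedX (T A : ChainComplex (ModuleCat.{u} R) ℤ) (n : ℤ) : Type u :=
  ⨁ p : pinchedIndex n, T.X p.1.1 ⊗[R] A.X p.1.2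

open Classical in
/-- The inclusion of `Tᵢ ⊗ Aⱼ` in the pinched tensor product in degree `n` if it is a summand there,
and zero otherwise. -/
def pinchedIncl (T A : ChainComplex (ModuleCat.{u} R) ℤ) (n i j : ℤ) :
    T.X i ⊗[R] A.X j →ₗ[R] PinchedX T A n :=
  if h : (i, j) ∈ pinchedIndex n then
    DirectSum.lof R (pinchedIndex n) (fun p => T.X p.1.1 ⊗[R] A.X p.1.2) ⟨(i, j), h⟩
  else 0

/-- The differential of the pinched tensor product from degree `n` to degree `m = n - 1`, on the
summand `Tᵢ ⊗ Aⱼ`: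
* for `n ≥ 1` it is the differential of `T_{≥0} ⊗ A_{≥0}`, that is,
  `x ⊗ y ↦ dx ⊗ y + (-1)ⁱ x ⊗ dy`, where terms outside of `T_{≥0} ⊗ A_{≥0}` are dropped;
* for `n = 0` (where `i = j = 0`) it is `x ⊗ y ↦ dx ⊗ dy` in `T₋₁ ⊗ A₋₁`;
* for `n ≤ -1` it is the differential of `T_{≤-1} ⊗ Σ(A_{≤-1})`, that is,
  `x ⊗ y ↦ dx ⊗ y - (-1)ⁱ x ⊗ dy`, as the differential of the shift is `-d`. -/
def pinchedComponent (T A : ChainComplex (ModuleCat.{u} R) ℤ) (n m i j : ℤ) :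
    T.X i ⊗[R] A.X j →ₗ[R] PinchedX T A m :=
  if 1 ≤ n then
    pinchedIncl T A m (i - 1) j ∘ₗ (T.d i (i - 1)).hom.rTensor (A.X j)
      + i.negOnePow • (pinchedIncl T A m i (j - 1) ∘ₗ (A.d j (j - 1)).hom.lTensor (T.X i))
  else if n = 0 then
    pinchedIncl T A m (-1) (-1) ∘ₗ TensorProduct.map (T.d i (-1)).hom (A.d j (-1)).hom
  else
    pinchedIncl T A m (i - 1) j ∘ₗ (T.d i (i - 1)).hom.rTensor (A.X j)
      - i.negOnePow • (pinchedIncl T A m i (j - 1) ∘ₗ (A.d j (j - 1)).hom.lTensor (T.X i))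

/-- The differential of the pinched tensor product. -/
def pinchedD (T A : ChainComplex (ModuleCat.{u} R) ℤ) (n m : ℤ) :
    PinchedX T A n →ₗ[R] PinchedX T A m :=
  if m + 1 = n then
    DirectSum.toModule R (pinchedIndex n) (PinchedX T A m)
      (fun p => pinchedComponent T A n m p.1.1 p.1.2)
  else 0

theorem pinchedD_incl (T A : ChainComplex (ModuleCat.{u} R) ℤ) (n m i j : ℤ) (hm : m + 1 = n)
    (h : (i, j) ∈ pinchedIndex n) (z : T.X i ⊗[R] A.X j) :
    pinchedD T A n m (pinchedIncl T A n i j z) = pinchedComponent T A n m i j z := by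
  simp only [pinchedD, hm, if_true, pinchedIncl, h, dif_pos]
  erw [DirectSum.toModule_lof]

theorem pinchedIncl_of_notMem (T A : ChainComplex (ModuleCat.{u} R) ℤ) (n i j : ℤ)
    (h : (i, j) ∉ pinchedIndex n) : pinchedIncl T A n i j = 0 := by
  simp [pinchedIncl, h]

set_option maxHeartbeats 1000000 in
theorem pinchedD_comp (T A : ChainComplex (ModuleCat.{u} R) ℤ) (n m l : ℤ)
    (hm : m + 1 = n) (hl : l + 1 = m) : pinchedD T A m l ∘ₗ pinchedD T A n m = 0 := by
  apply DirectSum.linearMap_ext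
  rintro ⟨⟨i, j⟩, h⟩
  apply TensorProduct.ext'
  intro x y
  have e : DirectSum.lof R (pinchedIndex n) (fun p => T.X p.1.1 ⊗[R] A.X p.1.2) ⟨(i, j), h⟩
      (x ⊗ₜ[R] y) = pinchedIncl T A n i j (x ⊗ₜ[R] y) := by
    simp [pinchedIncl, h]
  simp only [LinearMap.comp_apply, LinearMap.zero_apply]
  erw [e]
  rw [pinchedD_incl T A n m i j hm h]
  have hsign : (i - 1).negOnePow = -i.negOnePow := by
    rw [Int.negOnePow_sub, Int.negOnePow_one, mul_neg, mul_one]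
  have key (i' j' : ℤ) (z : T.X i' ⊗[R] A.X j')
      (h0 : (i', j') ∉ pinchedIndex m → pinchedComponent T A m l i' j' z = 0) :
      pinchedD T A m l (pinchedIncl T A m i' j' z) = pinchedComponent T A m l i' j' z := by
    by_cases hmem : (i', j') ∈ pinchedIndex m
    · exact pinchedD_incl T A m l i' j' hl hmem z
    · rw [h0 hmem, pinchedIncl_of_notMem T A m i' j' hmem]; simp
  simp only [pinchedIndex, Set.mem_ofPred_eq] at h
  rcases (by lia : 2 ≤ n ∨ n = 1 ∨ n = 0 ∨ n ≤ -1) with hn | hn | hn | hn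
  · have h1 : 1 ≤ n := by lia
    have h2 : 1 ≤ m := by lia
    have key' (i' j' : ℤ) (z : T.X i' ⊗[R] A.X j') :
        pinchedD T A m l (pinchedIncl T A m i' j' z) = pinchedComponent T A m l i' j' z := by
      apply key
      intro hmem
      simp only [pinchedIndex, Set.mem_ofPred_eq] at hmem
      rw [pinchedComponent, if_pos h2, pinchedIncl_of_notMem T A l (i' - 1) j',
        pinchedIncl_of_notMem T A l i' (j' - 1)]
      · simp
      all_goals simp only [pinchedIndex, Set.mem_ofPred_eq]; lia
    rw [pinchedComponent, if_pos h1]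
    simp [Units.smul_def, key', pinchedComponent, h2, d_d_apply, hsign]
  · subst hn
    obtain rfl : m = 0 := by lia
    have hz (i' j' : ℤ) (hij : i' + j' = 0) (z : T.X i' ⊗[R] A.X j')
        (hz : TensorProduct.map (T.d i' (-1)).hom (A.d j' (-1)).hom z = 0) :
        pinchedD T A 0 l (pinchedIncl T A 0 i' j' z) = 0 := by
      have hc : pinchedComponent T A 0 l i' j' z = 0 := by
        simp [pinchedComponent, hz]
      rw [key i' j' z (fun _ => hc), hc]
    rw [pinchedComponent, if_pos le_rfl]
    simp only [LinearMap.add_apply, LinearMap.comp_apply, map_add, Units.smul_def,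
      LinearMap.smul_apply, map_zsmul, LinearMap.rTensor_tmul, LinearMap.lTensor_tmul]
    rw [hz _ _ (by lia) _ (by simp [d_d_apply]), hz _ _ (by lia) _ (by simp [d_d_apply])]
    simp
  · subst hn
    obtain rfl : m = -1 := by lia
    have hmem : ((-1 : ℤ), (-1 : ℤ)) ∈ pinchedIndex (-1) := by
      simp [pinchedIndex]
    rw [pinchedComponent, if_neg (by norm_num), if_pos rfl]
    simp only [LinearMap.comp_apply]
    rw [pinchedD_incl T A (-1) l (-1) (-1) hl hmem]
    simp [pinchedComponent, d_d_apply]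
  · have key' (i' j' : ℤ) (hi : i' ≤ -1) (hj : j' ≤ -1) (hij : i' + (j' + 1) = m)
        (z : T.X i' ⊗[R] A.X j') :
        pinchedD T A m l (pinchedIncl T A m i' j' z) = pinchedComponent T A m l i' j' z := by
      apply key
      intro hmem
      simp only [pinchedIndex, Set.mem_ofPred_eq] at hmem
      lia
    have n1 : ¬ 1 ≤ n := by lia
    have n2 : ¬ n = 0 := by lia
    have n3 : ¬ 1 ≤ m := by lia
    have n4 : ¬ m = 0 := by lia
    rw [pinchedComponent, if_neg n1, if_neg n2]
    simp only [LinearMap.sub_apply, LinearMap.comp_apply, map_sub, Units.smul_def,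
      LinearMap.smul_apply, map_zsmul, LinearMap.rTensor_tmul, LinearMap.lTensor_tmul]
    rw [key' _ _ (by lia) (by lia) (by lia), key' _ _ (by lia) (by lia) (by lia)]
    simp [Units.smul_def, pinchedComponent, n3, n4, d_d_apply, hsign]

/-- The pinched tensor product of two `R`-complexes. -/
def pinchedTensor (T A : ChainComplex (ModuleCat.{u} R) ℤ) : ChainComplex (ModuleCat.{u} R) ℤ where
  X n := ModuleCat.of R (PinchedX T A n)
  d n m := ModuleCat.ofHom (pinchedD T A n m)
  shape n m h := by
    have h' : ¬ m + 1 = n := h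
    ext : 1
    simp [pinchedD, h']
  d_comp_d' n m l hm hl := by
    ext : 1
    simpa using pinchedD_comp T A n m l hm hl

end PinchedTensor

end

noncomputable section

namespace PinchedTensor

variable {R : Type u} [CommRing R]

/-! ### Acyclicity in terms of elements and of linear maps -/

/-! Write A for T'. Everything rests on one comparison (`homExactAt_pinchedTensor_iff_homExactAt`):
if Hom(A, Q) is exact, then Hom(T ⊠ A, Q) is exact in degree n if and only if Hom(T, Hom(N, Q)) is.
Here Q is any module, not necessarily projective.

Taking Q projective turns total acyclicity of T ⊠ A into the vanishing of Tate Ext with coefficients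
in Hom(N, Q). Taking Q to be the character module of R, an injective cogenerator, makes Hom(-, Q)
detect exactness. Hom-tensor adjunction then turns vanishing of Tate Tor into exactness of Hom(S,
Hom(N, Q)), so T ⊠ A is acyclic.

For the comparison, consider the bicomplex Hom(T_i, Hom(A_j, Q)). Each T_i is projective, so it is
exact in the j-direction, and its map from j = -1 to j = 0 factors through Hom(T_i, Hom(N, Q)).
Hence the part with j ≤ -1 resolves the complex Hom(T, Hom(N, Q)) from the left and the part with j
≥ 0 resolves it from the right. The pinched complex takes the quadrant i, j ≤ -1 of the former and
i, j ≥ 0 of the latter; (co)cycles are extended or corrected one entry at a time along antidiagonals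
(`exists_sweep`). Degrees 0 and -1, where the halves are glued, are treated directly.

The resolutions S and T of M may differ. Their cokernels are retracts of each other up to maps
factoring through projectives, and exactness of Hom into a fixed module passes to such retracts
(`IsCompleteResolution.homExactAt_of_homExactAt`). Finally, right exactness of the tensor product
identifies the cokernel in degree 0 with M ⊗ N. -/

theorem exactAt_iff_forall (C : ChainComplex (ModuleCat.{u} R) ℤ) (i j k : ℤ) (hij : j + 1 = i)
    (hjk : k + 1 = j) :
    C.ExactAt j ↔ ∀ x : C.X j, (C.d j k).hom x = 0 → ∃ y : C.X i, (C.d i j).hom y = x := by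
  rw [C.exactAt_iff' i j k ((ComplexShape.down ℤ).prev_eq' hij)
    ((ComplexShape.down ℤ).next_eq' hjk), ShortComplex.moduleCat_exact_iff]
  rfl

theorem acyclic_iff_forall (C : ChainComplex (ModuleCat.{u} R) ℤ) :
    C.Acyclic ↔ ∀ i j k : ℤ, j + 1 = i → k + 1 = j →
      Function.Exact (C.d i j).hom (C.d j k).hom := by
  constructor
  · intro h i j k hij hjk x
    refine ⟨fun hx => (exactAt_iff_forall C i j k hij hjk).1 (h j) x hx, ?_⟩
    rintro ⟨y, rfl⟩
    exact d_d_apply C i j k y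
  · intro h j
    rw [exactAt_iff_forall C (j + 1) j (j - 1) rfl (by lia)]
    exact fun x hx => (h _ _ _ rfl (by lia) x).1 hx

/-- Exactness of `Hom(T, X)` at `Hom(Tₙ, X)`. -/
def HomExactAt (T : ChainComplex (ModuleCat.{u} R) ℤ) (X : Type u) [AddCommGroup X] [Module R X]
    (n : ℤ) : Prop :=
  ∀ m l : ℤ, n + 1 = m → l + 1 = n → ∀ φ : T.X n →ₗ[R] X, φ ∘ₗ (T.d m n).hom = 0 →
    ∃ ψ : T.X l →ₗ[R] X, ψ ∘ₗ (T.d n l).hom = φ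

/-- The signs in the differential are units, so they affect neither kernels nor images; only the
reversal of degrees remains. -/
theorem homModule_exactAt_iff (T : ChainComplex (ModuleCat.{u} R) ℤ) (X : Type u) [AddCommGroup X]
    [Module R X] (n : ℤ) : (homModule T X).ExactAt n ↔ HomExactAt T X (-n) := by
  have unit_smul (a : ℤ) (φ : T.X (-(a - 1)) →ₗ[R] X) :
      (-(a.negOnePow • φ) = 0 ↔ φ = 0) := by
    rw [neg_eq_zero, smul_eq_zero_iff_eq]
  rw [exactAt_iff_forall _ (n + 1) n (n - 1) rfl (by lia)]
  constructor
  · rintro h m l rfl hl φ hφ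
    obtain rfl : l = -(n + 1) := by lia
    have hm : -n + 1 = -(n - 1) := by lia
    rw [hm] at hφ
    obtain ⟨ψ, hψ⟩ := h φ ((unit_smul _ _).2 hφ)
    refine ⟨-((n + 1).negOnePow • (ψ : T.X (-(n + 1)) →ₗ[R] X)), ?_⟩
    rw [← hψ]
    rfl
  · intro h φ hφ
    obtain ⟨ψ, hψ⟩ := h (-(n - 1)) (-(n + 1)) (by lia) (by lia) φ ((unit_smul _ _).1 hφ)
    refine ⟨-((n + 1).negOnePow • (ψ : T.X (-(n + 1)) →ₗ[R] X)), ?_⟩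
    rw [← hψ]
    change -((n + 1).negOnePow • LinearMap.lcomp R X (T.d (-n) (-(n + 1))).hom
      (-((n + 1).negOnePow • (ψ : T.X (-(n + 1)) →ₗ[R] X)))) = _
    rw [map_neg, smul_neg, neg_neg]
    ext x
    simp [Units.smul_def, smul_smul, ← Units.val_mul]

theorem homModule_acyclic_iff (T : ChainComplex (ModuleCat.{u} R) ℤ) (X : Type u) [AddCommGroup X]
    [Module R X] : (homModule T X).Acyclic ↔ ∀ n, HomExactAt T X n := by
  refine ⟨fun h n => ?_, fun h n => (homModule_exactAt_iff T X n).2 (h _)⟩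
  have := (homModule_exactAt_iff T X (-n)).1 (h _)
  rwa [neg_neg] at this

theorem acyclic_iff_isZero_homology (C : ChainComplex (ModuleCat.{u} R) ℤ) :
    C.Acyclic ↔ ∀ i, Limits.IsZero (C.homology i) :=
  forall_congr' fun i => C.exactAt_iff_isZero_homology i

theorem isZero_tateExt_iff (T : ChainComplex (ModuleCat.{u} R) ℤ) (X : Type u) [AddCommGroup X]
    [Module R X] : (∀ i, Limits.IsZero (tateExt T X i)) ↔ ∀ n, HomExactAt T X n := by
  rw [← homModule_acyclic_iff]
  refine ⟨fun h i => ?_, fun h i => (acyclic_iff_isZero_homology _).1 h _⟩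
  have := ((homModule T X).exactAt_iff_isZero_homology _).2 (h (-i))
  rwa [neg_neg] at this

theorem isZero_tateTor_iff (T : ChainComplex (ModuleCat.{u} R) ℤ) (X : Type u) [AddCommGroup X]
    [Module R X] : (∀ i, Limits.IsZero (tateTor T X i)) ↔ (tensorModule T X).Acyclic :=
  (acyclic_iff_isZero_homology _).symm

/-! ### An injective cogenerator -/

/-- Injectivity of the character module of R amounts to flatness of R. -/
theorem exists_extend_characterModule {X Y : Type u} [AddCommGroup X] [Module R X]
    [AddCommGroup Y] [Module R Y] (f : X →ₗ[R] Y) (hf : Function.Injective f)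
    (φ : X →ₗ[R] CharacterModule R) : ∃ ψ : Y →ₗ[R] CharacterModule R, ψ ∘ₗ f = φ :=
  rTensor_injective_iff_lcomp_surjective.1
    (Module.Flat.rTensor_preserves_injective_linearMap f hf) φ

theorem exists_linearMap_characterModule_ne_zero {X : Type u} [AddCommGroup X] [Module R X]
    {x : X} (hx : x ≠ 0) : ∃ φ : X →ₗ[R] CharacterModule R, φ x ≠ 0 := by
  obtain ⟨c, hc⟩ := CharacterModule.exists_character_apply_ne_zero_of_ne_zero hx
  -- This is the map x ↦ (r ↦ c (r • x)); evaluating at r = 1 recovers c.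
  refine ⟨CharacterModule.homEquiv.symm (CharacterModule.dual (TensorProduct.rid R X).toLinearMap c),
    fun h => hc ?_⟩
  have : c (TensorProduct.rid R X (x ⊗ₜ[R] 1)) = 0 := DFunLike.congr_fun h 1
  simpa using this

theorem exists_extend_of_exact {X Y Z : Type u} [AddCommGroup X] [Module R X] [AddCommGroup Y]
    [Module R Y] [AddCommGroup Z] [Module R Z] {f : X →ₗ[R] Y} {g : Y →ₗ[R] Z}
    (h : Function.Exact f g) (φ : Y →ₗ[R] CharacterModule R) (hφ : φ ∘ₗ f = 0) :
    ∃ ψ : Z →ₗ[R] CharacterModule R, ψ ∘ₗ g = φ := by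
  have hle : LinearMap.ker g ≤ LinearMap.ker φ := by
    intro y hy
    obtain ⟨x, rfl⟩ := (h y).1 hy
    exact LinearMap.congr_fun hφ x
  obtain ⟨ψ, hψ⟩ := exists_extend_characterModule ((LinearMap.ker g).liftQ g le_rfl)
    (LinearMap.ker_eq_bot.1 (Submodule.ker_liftQ_eq_bot _ _ _ le_rfl))
    ((LinearMap.ker g).liftQ φ hle)
  refine ⟨ψ, LinearMap.ext fun y => ?_⟩
  exact LinearMap.congr_fun hψ (Submodule.Quotient.mk y)

theorem acyclic_iff_homExactAt_characterModule (C : ChainComplex (ModuleCat.{u} R) ℤ) :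
    C.Acyclic ↔ ∀ n, HomExactAt C (CharacterModule R) n := by
  constructor
  · rintro h n m l hm hl φ hφ
    exact exists_extend_of_exact ((acyclic_iff_forall C).1 h m n l hm hl) φ hφ
  · intro h n
    rw [exactAt_iff_forall C (n + 1) n (n - 1) rfl (by lia)]
    intro x hx
    by_contra! hne
    have hx' : Submodule.Quotient.mk (p := LinearMap.range (C.d (n + 1) n).hom) x ≠ 0 := by
      rw [Ne, Submodule.Quotient.mk_eq_zero]
      rintro ⟨y, hy⟩
      exact hne y hy
    -- A functional that kills boundaries but not x would have to factor through the differential,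
    -- which kills x.
    obtain ⟨φ, hφ⟩ := exists_linearMap_characterModule_ne_zero (R := R) hx'
    obtain ⟨ψ, hψ⟩ := h n (n + 1) (n - 1) rfl (by lia) 
      (φ ∘ₗ Submodule.mkQ (LinearMap.range (C.d (n + 1) n).hom)) (by
      rw [LinearMap.comp_assoc, LinearMap.range_mkQ_comp, LinearMap.comp_zero])
    apply hφ
    have := LinearMap.congr_fun hψ x
    simp only [LinearMap.comp_apply, hx, map_zero] at this
    exact this.symm

/-- Hom-tensor adjunction, applied degree by degree. -/
theorem homExactAt_tensorModule_iff (T : ChainComplex (ModuleCat.{u} R) ℤ) (N Q : Type u)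
    [AddCommGroup N] [Module R N] [AddCommGroup Q] [Module R Q] (n : ℤ) :
    HomExactAt (tensorModule T N) Q n ↔ HomExactAt T (N →ₗ[R] Q) n := by
  constructor
  · intro h m l hm hl φ hφ
    obtain ⟨ψ, hψ⟩ := h m l hm hl (TensorProduct.lift φ) (TensorProduct.ext' fun x y =>
      LinearMap.congr_fun (LinearMap.congr_fun hφ x) y)
    refine ⟨TensorProduct.curry ψ, ?_⟩
    ext x y
    exact LinearMap.congr_fun hψ (x ⊗ₜ[R] y)
  · intro h m l hm hl φ hφ
    obtain ⟨ψ, hψ⟩ := h m l hm hl (TensorProduct.curry φ) (by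
      ext x y
      exact LinearMap.congr_fun hφ (x ⊗ₜ[R] y))
    refine ⟨TensorProduct.lift ψ, TensorProduct.ext' fun x y => ?_⟩
    exact LinearMap.congr_fun (LinearMap.congr_fun hψ x) y

/-! ### Stable retracts and the independence of Tate cohomology of the resolution -/

/-- `C` is a retract of `C'` up to maps that factor through a projective module. -/
def StableRetract (R : Type u) [CommRing R] (C C' : Type u) [AddCommGroup C] [Module R C]
    [AddCommGroup C'] [Module R C'] : Prop :=
  ∃ (Q : ModuleCat.{u} R) (f : C →ₗ[R] C') (g : C' →ₗ[R] C) (a : C →ₗ[R] Q) (b : Q →ₗ[R] C),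
    Module.Projective R Q ∧ ∀ x, g (f x) + b (a x) = x

theorem StableRetract.of_equiv {C C' : Type u} [AddCommGroup C] [Module R C] [AddCommGroup C']
    [Module R C'] (e : C ≃ₗ[R] C') : StableRetract R C C' :=
  ⟨ModuleCat.of R PUnit.{u + 1}, e, e.symm, 0, 0,
    inferInstanceAs (Module.Projective R PUnit.{u + 1}), by simp⟩

section ShortExact

variable {K P C : Type u} [AddCommGroup K] [Module R K] [AddCommGroup P] [Module R P]
  [AddCommGroup C] [Module R C] {ι : K →ₗ[R] P} {π : P →ₗ[R] C}

theorem exists_lift_of_exact (hι : Function.Injective ι) (h : Function.Exact ι π)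
    {X : Type u} [AddCommGroup X] [Module R X] (φ : X →ₗ[R] P) (hφ : ∀ x, π (φ x) = 0) :
    ∃ ψ : X →ₗ[R] K, ∀ x, ι (ψ x) = φ x := by
  have hmem (x : X) : φ x ∈ LinearMap.range ι := (h _).1 (hφ x)
  refine ⟨(LinearEquiv.ofInjective ι hι).symm.toLinearMap ∘ₗ φ.codRestrict _ hmem, fun x => ?_⟩
  exact congrArg Subtype.val
    ((LinearEquiv.ofInjective ι hι).apply_symm_apply (φ.codRestrict _ hmem x))

theorem exists_desc_of_exact (hπ : Function.Surjective π) (h : Function.Exact ι π)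
    {X : Type u} [AddCommGroup X] [Module R X] (φ : P →ₗ[R] X) (hφ : ∀ x, φ (ι x) = 0) :
    ∃ ψ : C →ₗ[R] X, ∀ x, ψ (π x) = φ x := by
  have hle : LinearMap.ker π ≤ LinearMap.ker φ := by
    intro y hy
    obtain ⟨x, rfl⟩ := (h y).1 hy
    exact hφ x
  refine ⟨(LinearMap.ker π).liftQ φ hle ∘ₗ (π.quotKerEquivOfSurjective hπ).symm.toLinearMap,
    fun x => ?_⟩
  have : (π.quotKerEquivOfSurjective hπ).symm (π x) = Submodule.Quotient.mk x := by
    rw [LinearEquiv.symm_apply_eq]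
    rfl
  simp [this]

variable {K' P' C' : Type u} [AddCommGroup K'] [Module R K'] [AddCommGroup P'] [Module R P']
  [AddCommGroup C'] [Module R C'] {ι' : K' →ₗ[R] P'} {π' : P' →ₗ[R] C'}

/-- Schanuel-type argument: projectivity lifts all maps between the cokernels to P and P'. The
defect of the lifted composite from the identity of P lands in K, so on K it factors through ι, that
is, through the projective P. -/
theorem StableRetract.syzygy [Module.Projective R P] [Module.Projective R P']
    (hι : Function.Injective ι) (hπ : Function.Surjective π) (h : Function.Exact ι π)
    (hι' : Function.Injective ι') (hπ' : Function.Surjective π') (h' : Function.Exact ι' π')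
    (hC : StableRetract R C C') : StableRetract R K K' := by
  obtain ⟨Q, f, g, a, b, hQ, hfg⟩ := hC
  obtain ⟨F, hF⟩ := Module.projective_lifting_property π' (f ∘ₗ π) hπ'
  obtain ⟨G, hG⟩ := Module.projective_lifting_property π (g ∘ₗ π') hπ
  obtain ⟨β, hβ⟩ := Module.projective_lifting_property π b hπ
  replace hF (x) : π' (F x) = f (π x) := LinearMap.congr_fun hF x
  replace hG (x) : π (G x) = g (π' x) := LinearMap.congr_fun hG x
  replace hβ (x) : π (β x) = b x := LinearMap.congr_fun hβ x
  obtain ⟨f', hf'⟩ := exists_lift_of_exact hι' h' (F ∘ₗ ι)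
    (fun x => by simp [hF, h.apply_apply_eq_zero])
  obtain ⟨g', hg'⟩ := exists_lift_of_exact hι h (G ∘ₗ ι')
    (fun x => by simp [hG, h'.apply_apply_eq_zero])
  obtain ⟨θ, hθ⟩ := exists_lift_of_exact hι h (LinearMap.id - G ∘ₗ F - β ∘ₗ a ∘ₗ π) (fun x => by
    simp only [LinearMap.sub_apply, LinearMap.id_apply, LinearMap.comp_apply, map_sub, hG, hF, hβ]
    nth_rewrite 1 [← hfg (π x)]
    abel)
  refine ⟨ModuleCat.of R P, f', g', ι, θ, inferInstanceAs (Module.Projective R P), fun x => hι ?_⟩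
  rw [map_add, hg', hθ]
  simp [hf', h.apply_apply_eq_zero]

/-- Dual to `StableRetract.syzygy`: extending maps from K and K' into projectives replaces lifting,
and the defect now factors through π. -/
theorem StableRetract.cosyzygy [Module.Projective R P] [Module.Projective R P']
    (hπ : Function.Surjective π) (h : Function.Exact ι π)
    (hπ' : Function.Surjective π') (h' : Function.Exact ι' π')
    (hext : ∀ (Q : Type u) [AddCommGroup Q] [Module R Q] [Module.Projective R Q] (φ : K →ₗ[R] Q),
      ∃ ψ : P →ₗ[R] Q, ψ ∘ₗ ι = φ)
    (hext' : ∀ (Q : Type u) [AddCommGroup Q] [Module R Q] [Module.Projective R Q] (φ : K' →ₗ[R] Q),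
      ∃ ψ : P' →ₗ[R] Q, ψ ∘ₗ ι' = φ)
    (hK : StableRetract R K K') : StableRetract R C C' := by
  obtain ⟨Q, f, g, a, b, hQ, hfg⟩ := hK
  obtain ⟨F, hF⟩ := hext P' (ι' ∘ₗ f)
  obtain ⟨G, hG⟩ := hext' P (ι ∘ₗ g)
  obtain ⟨α, hα⟩ := hext Q a
  replace hF (x) : F (ι x) = ι' (f x) := LinearMap.congr_fun hF x
  replace hG (x) : G (ι' x) = ι (g x) := LinearMap.congr_fun hG x
  replace hα (x) : α (ι x) = a x := LinearMap.congr_fun hα x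
  obtain ⟨f', hf'⟩ := exists_desc_of_exact hπ h (π' ∘ₗ F)
    (fun x => by simp [hF, h'.apply_apply_eq_zero])
  obtain ⟨g', hg'⟩ := exists_desc_of_exact hπ' h' (π ∘ₗ G)
    (fun x => by simp [hG, h.apply_apply_eq_zero])
  obtain ⟨θ, hθ⟩ := exists_desc_of_exact hπ h (LinearMap.id - G ∘ₗ F - ι ∘ₗ b ∘ₗ α) (fun x => by
    simp only [LinearMap.sub_apply, LinearMap.id_apply, LinearMap.comp_apply, hG, hF, hα]
    nth_rewrite 1 [← hfg x]
    rw [map_add]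
    abel)
  refine ⟨ModuleCat.of R P, f', g', θ, π, inferInstanceAs (Module.Projective R P), fun y => ?_⟩
  obtain ⟨x, rfl⟩ := hπ y
  rw [hθ, hf']
  simp [hg', h.apply_apply_eq_zero]

end ShortExact

/-! ### Cokernels in complete resolutions -/

/-- The cokernel of `d : Tₙ₊₁ → Tₙ`. -/
abbrev Coker (T : ChainComplex (ModuleCat.{u} R) ℤ) (n : ℤ) : Type u :=
  T.X n ⧸ LinearMap.range (T.d (n + 1) n).hom

/-- The map `Coker (Tₙ₊₂ → Tₙ₊₁) → Tₙ` induced by the differential. -/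
def cokerD (T : ChainComplex (ModuleCat.{u} R) ℤ) (n : ℤ) : Coker T (n + 1) →ₗ[R] T.X n :=
  Submodule.liftQ _ (T.d (n + 1) n).hom (by
    rintro _ ⟨x, rfl⟩
    exact d_d_apply T _ _ _ x)

theorem cokerD_comp_mkQ (T : ChainComplex (ModuleCat.{u} R) ℤ) (n : ℤ) :
    cokerD T n ∘ₗ Submodule.mkQ _ = (T.d (n + 1) n).hom :=
  Submodule.liftQ_mkQ _ _ _

theorem cokerD_injective {T : ChainComplex (ModuleCat.{u} R) ℤ} (hT : T.Acyclic) (n : ℤ) :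
    Function.Injective (cokerD T n) := by
  refine LinearMap.ker_eq_bot.1 (Submodule.ker_liftQ_eq_bot _ _ _ fun x hx => ?_)
  exact ((acyclic_iff_forall T).1 hT (n + 1 + 1) (n + 1) n rfl rfl x).1 hx

theorem cokerD_exact (T : ChainComplex (ModuleCat.{u} R) ℤ) (n : ℤ) :
    Function.Exact (cokerD T n) (Submodule.mkQ (LinearMap.range (T.d (n + 1) n).hom)) := by
  rw [LinearMap.exact_iff, Submodule.ker_mkQ, cokerD, Submodule.range_liftQ]

theorem homExactAt_succ_iff (T : ChainComplex (ModuleCat.{u} R) ℤ) (X : Type u) [AddCommGroup X]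
    [Module R X] (n : ℤ) :
    HomExactAt T X (n + 1) ↔
      ∀ φ : Coker T (n + 1) →ₗ[R] X, ∃ ψ : T.X n →ₗ[R] X, ψ ∘ₗ cokerD T n = φ := by
  constructor
  · intro h φ
    obtain ⟨ψ, hψ⟩ := h (n + 1 + 1) n rfl rfl (φ ∘ₗ Submodule.mkQ _) (by
      rw [LinearMap.comp_assoc, LinearMap.range_mkQ_comp, LinearMap.comp_zero])
    refine ⟨ψ, Submodule.linearMap_qext _ ?_⟩
    rw [LinearMap.comp_assoc, cokerD_comp_mkQ, hψ]
  · rintro h m l rfl hl φ hφ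
    obtain rfl : l = n := by lia
    obtain ⟨ψ, hψ⟩ := h (Submodule.liftQ _ φ (LinearMap.range_le_ker_iff.2 hφ))
    refine ⟨ψ, ?_⟩
    rw [← cokerD_comp_mkQ, ← LinearMap.comp_assoc, hψ, Submodule.liftQ_mkQ]

theorem IsTotallyAcyclic.homExactAt {T : ChainComplex (ModuleCat.{u} R) ℤ}
    (hT : IsTotallyAcyclic T) (Q : Type u) [AddCommGroup Q] [Module R Q] [Module.Projective R Q]
    (n : ℤ) : HomExactAt T Q n :=
  (homModule_acyclic_iff T Q).1 (hT.hom_acyclic Q) n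

/-- Both cokernels in degree 0 are M. Acyclicity propagates the retraction to higher degrees, and
exactness of Hom into projectives propagates it to lower ones. -/
theorem IsCompleteResolution.stableRetract {S T : ChainComplex (ModuleCat.{u} R) ℤ} {M : Type u}
    [AddCommGroup M] [Module R M] (hS : IsCompleteResolution S M) (hT : IsCompleteResolution T M)
    (n : ℤ) : StableRetract R (Coker S n) (Coker T n) := by
  have pS := hS.totallyAcyclic.projective
  have pT := hT.totallyAcyclic.projective
  have up (n : ℤ) (h : StableRetract R (Coker S n) (Coker T n)) :
      StableRetract R (Coker S (n + 1)) (Coker T (n + 1)) :=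
    h.syzygy (cokerD_injective hS.totallyAcyclic.acyclic n) (Submodule.mkQ_surjective _)
      (cokerD_exact S n) (cokerD_injective hT.totallyAcyclic.acyclic n)
      (Submodule.mkQ_surjective _) (cokerD_exact T n)
  have down (n : ℤ) (h : StableRetract R (Coker S (n + 1)) (Coker T (n + 1))) :
      StableRetract R (Coker S n) (Coker T n) :=
    h.cosyzygy (Submodule.mkQ_surjective _) (cokerD_exact S n) (Submodule.mkQ_surjective _)
      (cokerD_exact T n)
      (fun Q _ _ _ => (homExactAt_succ_iff S Q n).1 (hS.totallyAcyclic.homExactAt Q _))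
      (fun Q _ _ _ => (homExactAt_succ_iff T Q n).1 (hT.totallyAcyclic.homExactAt Q _))
  induction n using Int.induction_on with
  | zero =>
    obtain ⟨e⟩ := hS.coker
    obtain ⟨e'⟩ := hT.coker
    exact StableRetract.of_equiv (e.trans e'.symm)
  | succ i ih => exact up _ ih
  | pred i ih =>
    apply down
    rwa [sub_add_cancel]

theorem IsCompleteResolution.homExactAt_of_homExactAt {S T : ChainComplex (ModuleCat.{u} R) ℤ}
    {M : Type u} [AddCommGroup M] [Module R M] (hS : IsCompleteResolution S M)
    (hT : IsCompleteResolution T M) (X : Type u) [AddCommGroup X] [Module R X] (n : ℤ)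
    (h : HomExactAt S X n) : HomExactAt T X n := by
  obtain ⟨k, rfl⟩ : ∃ k, n = k + 1 := ⟨n - 1, by lia⟩
  obtain ⟨Q, f, g, a, b, hQ, hfg⟩ := hT.stableRetract hS (k + 1)
  rw [homExactAt_succ_iff] at h ⊢
  intro φ
  have hext := (homExactAt_succ_iff T Q k).1 (hT.totallyAcyclic.homExactAt Q _)
  have := hS.totallyAcyclic.projective k
  have hext' := (homExactAt_succ_iff T (S.X k) k).1 (hT.totallyAcyclic.homExactAt _ _)
  obtain ⟨ψ, hψ⟩ := h (φ ∘ₗ g)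
  obtain ⟨α, hα⟩ := hext a
  obtain ⟨F, hF⟩ := hext' (cokerD S k ∘ₗ f)
  -- Since φ = φ g f + φ b a, it suffices to extend each summand: the first through S_k, using that
  -- f extends to F because S_k is projective, and the second through Q.
  refine ⟨ψ ∘ₗ F + φ ∘ₗ b ∘ₗ α, LinearMap.ext fun x => ?_⟩
  have h1 : F (cokerD T k x) = cokerD S k (f x) := LinearMap.congr_fun hF x
  have h2 : α (cokerD T k x) = a x := LinearMap.congr_fun hα x
  have h3 : ψ (cokerD S k (f x)) = φ (g (f x)) := LinearMap.congr_fun hψ (f x)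
  simp only [LinearMap.comp_apply, LinearMap.add_apply, h1, h2, h3]
  rw [← map_add, hfg]

/-! ### Pinched total complexes of bicomplexes -/

/-- A bicomplex with commuting differentials, for which the complexes `B i •` are exact, along with
the complex `Z` of the images of `B i (-1) → B i 0`. -/
structure ResolvedBicomplex (R : Type u) [CommRing R] where
  B : ℤ → ℤ → Type u
  Z : ℤ → Type u
  [groupB : ∀ i j, AddCommGroup (B i j)]
  [moduleB : ∀ i j, Module R (B i j)]
  [groupZ : ∀ i, AddCommGroup (Z i)]
  [moduleZ : ∀ i, Module R (Z i)]
  dh (i i' j : ℤ) : B i j →ₗ[R] B i' j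
  dv (i j j' : ℤ) : B i j →ₗ[R] B i j'
  dz (i i' : ℤ) : Z i →ₗ[R] Z i'
  p (i : ℤ) : B i (-1) →ₗ[R] Z i
  q (i : ℤ) : Z i →ₗ[R] B i 0
  dh_dh (i i' i'' j : ℤ) (x : B i j) : dh i' i'' j (dh i i' j x) = 0
  dh_dv (i i' j j' : ℤ) (x : B i j) : dh i i' j' (dv i j j' x) = dv i' j j' (dh i i' j x)
  exact_dv (i j j' j'' : ℤ) : j + 1 = j' → j' + 1 = j'' → Function.Exact (dv i j j') (dv i j' j'')
  p_surjective (i : ℤ) : Function.Surjective (p i)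
  exact_p (i : ℤ) : Function.Exact (dv i (-2) (-1)) (p i)
  q_injective (i : ℤ) : Function.Injective (q i)
  exact_q (i : ℤ) : Function.Exact (q i) (dv i 0 1)
  q_p (i : ℤ) (x : B i (-1)) : q i (p i x) = dv i (-1) 0 x
  dz_p (i i' : ℤ) (x : B i (-1)) : dz i i' (p i x) = p i' (dh i i' (-1) x)
  q_dz (i i' : ℤ) (x : Z i) : q i' (dz i i' x) = dh i i' 0 (q i x)

namespace ResolvedBicomplex

attribute [instance] groupB moduleB groupZ moduleZ

theorem map_units_smul {X Y : Type u} [AddCommGroup X] [Module R X] [AddCommGroup Y] [Module R Y]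
    (f : X →ₗ[R] Y) (a : ℤˣ) (x : X) : f (a • x) = a • f x := by
  simp [Units.smul_def]

variable (K : ResolvedBicomplex R)

/-- Exactness of the complex `Z` in degree `n`. -/
def ZExactAt (n : ℤ) : Prop :=
  ∀ m l : ℤ, m + 1 = n → n + 1 = l → ∀ ζ : K.Z n, K.dz n l ζ = 0 → ∃ ξ : K.Z m, K.dz m n ξ = ζ

variable {K}

/-- The entry in position `(i, j)` of the total differential of `w`, with signs `s`, is `z i j`. -/
def TotEq (s : ℤ → ℤˣ) (w z : ∀ i j, K.B i j) (i j : ℤ) : Prop :=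
  ∀ i' j', i' + 1 = i → j' + 1 = j →
    K.dh i' i j (w i' j) + s i • K.dv i j' j (w i j') = z i j

/-- The family `w` with its entry in position `(i, j)` replaced by `v`. -/
def upd (w : ∀ i j, K.B i j) (i j : ℤ) (v : K.B i j) : ∀ i j, K.B i j :=
  Function.update w i (Function.update (w i) j v)

@[simp] theorem upd_self (w : ∀ i j, K.B i j) (i j : ℤ) (v : K.B i j) : upd w i j v i j = v := by
  simp [upd]

theorem upd_of_ne (w : ∀ i j, K.B i j) (i j : ℤ) (v : K.B i j) (a b : ℤ) (h : a ≠ i ∨ b ≠ j) :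
    upd w i j v a b = w a b := by
  by_cases ha : a = i
  · subst ha
    have hb : b ≠ j := by tauto
    simp [upd, hb]
  · simp [upd, ha]

theorem TotEq.zero (s : ℤ → ℤˣ) (i j : ℤ) : TotEq (K := K) s 0 0 i j := by
  intro i' j' _ _
  simp

theorem TotEq.congr {s : ℤ → ℤˣ} {w w' z z' : ∀ i j, K.B i j} {i j : ℤ} (h : TotEq s w z i j)
    (h1 : ∀ i', i' + 1 = i → w' i' j = w i' j) (h2 : ∀ j', j' + 1 = j → w' i j' = w i j')
    (h3 : z' i j = z i j) : TotEq s w' z' i j := by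
  intro i' j' hi hj
  rw [h1 i' hi, h2 j' hj, h3, h i' j' hi hj]

variable {s : ℤ → ℤˣ}

/-- Apply `dh` to the equation for w and compare with the cocycle equation for z; the alternation of
the signs makes the terms cancel. This is the obstruction to solving for the next entry of w. -/
theorem dv_sub_dh_eq_zero (hs : ∀ i, s (i + 1) = -s i) {w z : ∀ i j, K.B i j} {i' i j j' : ℤ}
    (hi : i' + 1 = i) (hj : j + 1 = j') (hw : TotEq s w z i' j') (hz : TotEq s z 0 i j') :
    K.dv i j j' (z i j - K.dh i' i j (w i' j)) = 0 := by
  have h1 := hz i' j hi hj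
  have h2 := congrArg (K.dh i' i j') (hw (i' - 1) j (by lia) hj)
  subst hi
  rw [map_add, K.dh_dh, zero_add, map_units_smul, K.dh_dv] at h2
  rw [← h2, hs, Pi.zero_apply, Pi.zero_apply, Units.neg_smul, ← sub_eq_add_neg, ← smul_sub,
    smul_eq_zero_iff_eq] at h1
  rw [map_sub, ← neg_sub, h1, neg_zero]

/-- On the antidiagonal i + j = m, the equation in column i determines `dv` of the entry `w i (j -
1)` once `w (i - 1) j` is known. The previous equation makes the required value a `dv`-cocycle, so
exactness in the j-direction supplies the entry. -/
theorem exists_sweep (hs : ∀ i, s (i + 1) = -s i) (w z : ∀ i j, K.B i j) (m a : ℤ) (k : ℕ)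
    (hw : ∀ j, a + j = m → TotEq s w z a j)
    (hz : ∀ i j, i + j = m + 1 → a < i → i ≤ a + k → TotEq s z 0 i j) :
    ∃ w' : ∀ i j, K.B i j, (∀ i j, i + j = m → a ≤ i → i ≤ a + k → TotEq s w' z i j) ∧
      ∀ i j, (i ≤ a ∨ a + k < i) → w' i j = w i j := by
  induction k with
  | zero =>
    refine ⟨w, fun i j hij h1 h2 => ?_, fun _ _ _ => rfl⟩
    obtain rfl : i = a := by push_cast at h2; lia
    exact hw j hij
  | succ k ih =>
    obtain ⟨w', hw', hsame⟩ := ih fun i j hij h1 h2 => hz i j hij h1 (by push_cast; lia)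
    push_cast at hz ⊢
    obtain ⟨i, hi⟩ : ∃ i, i = a + k + 1 := ⟨_, rfl⟩
    obtain ⟨j, hj⟩ : ∃ j, i + j = m := ⟨m - i, by lia⟩
    have hcl := dv_sub_dh_eq_zero hs (show i - 1 + 1 = i by lia) (show j + 1 = j + 1 from rfl)
      (hw' (i - 1) (j + 1) (by lia) (by lia) (by lia)) (hz i (j + 1) (by lia) (by lia) (by lia))
    obtain ⟨v, hv⟩ := (K.exact_dv i (j - 1) j (j + 1) (by lia) rfl _).1 hcl
    refine ⟨upd w' i (j - 1) (s i • v), fun i₁ j₁ h₁ h₂ h₃ => ?_, fun i₁ j₁ h₁ => ?_⟩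
    · by_cases hlt : i₁ = i
      · subst hlt
        obtain rfl : j₁ = j := by lia
        intro i' j' hi' hj'
        obtain rfl : i' = i₁ - 1 := by lia
        obtain rfl : j' = j₁ - 1 := by lia
        rw [upd_self, upd_of_ne _ _ _ _ _ _ (by lia), map_units_smul, smul_smul, Int.units_mul_self,
          one_smul, hv]
        abel
      · exact (hw' i₁ j₁ h₁ h₂ (by lia)).congr (fun _ _ => upd_of_ne _ _ _ _ _ _ (by lia))
          (fun _ _ => upd_of_ne _ _ _ _ _ _ (by lia)) rfl
    · rw [upd_of_ne _ _ _ _ _ _ (by lia)]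
      exact hsame i₁ j₁ (by lia)

/-! ### Comparing exactness of Z with exactness of the two quadrants -/

/-- Exactness in degree `n ≤ -2` of the pinched total complex. -/
def NegExactAt (K : ResolvedBicomplex R) (s : ℤ → ℤˣ) (n : ℤ) : Prop :=
  ∀ z : ∀ i j, K.B i j, (∀ i j, i ≤ -1 → j ≤ -1 → i + j = n → TotEq s z 0 i j) →
    ∃ w : ∀ i j, K.B i j, ∀ i j, i ≤ -1 → j ≤ -1 → i + j = n - 1 → TotEq s w z i j

/-- Exactness in degree `n ≥ 1` of the pinched total complex. -/
def PosExactAt (K : ResolvedBicomplex R) (s : ℤ → ℤˣ) (n : ℤ) : Prop :=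
  ∀ z : ∀ i j, K.B i j, (∀ i j, i < 0 ∨ j < 0 → z i j = 0) →
    (∀ i j, 0 ≤ i → 0 ≤ j → i + j = n + 1 → TotEq s z 0 i j) →
    ∃ w : ∀ i j, K.B i j, (∀ i j, i < 0 ∨ j < 0 → i + j = n - 1 → w i j = 0) ∧
      ∀ i j, 0 ≤ i → 0 ≤ j → i + j = n → TotEq s w z i j

/-- Under p the edge entry `z n (-1)` becomes a cocycle of Z. A primitive of it, lifted along p,
solves the equation at the edge, and a sweep over the columns n to -1 solves the others. -/
theorem negExactAt_of_zExactAt (hs : ∀ i, s (i + 1) = -s i) {n : ℤ} (hn : n ≤ -2)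
    (h : K.ZExactAt n) : K.NegExactAt s n := by
  intro z hz
  have h1 : K.dz n (n + 1) (K.p n (z n (-1))) = 0 := by
    have := hz (n + 1) (-1) (by lia) le_rfl (by lia) n (-2) rfl rfl
    rw [K.dz_p, eq_neg_of_add_eq_zero_left this, ← smul_neg, ← map_neg, map_units_smul,
      (K.exact_p _).apply_apply_eq_zero, smul_zero]
  obtain ⟨ξ, hξ⟩ := h (n - 1) (n + 1) (by lia) rfl _ h1
  obtain ⟨w₀, rfl⟩ := K.p_surjective _ ξ
  rw [K.dz_p, eq_comm, ← sub_eq_zero, ← map_sub] at hξ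
  obtain ⟨v, hv⟩ := (K.exact_p _ _).1 hξ
  obtain ⟨w, hw, -⟩ := exists_sweep hs (upd (upd 0 (n - 1) (-1) w₀) n (-2) (s n • v)) z (n - 1) n
    (-1 - n).toNat (by
      intro j hj i' j' hi' hj'
      obtain rfl : j = -1 := by lia
      obtain rfl : j' = -2 := by lia
      obtain rfl : i' = n - 1 := by lia
      rw [upd_self, upd_of_ne _ _ _ _ _ _ (by lia), upd_self, map_units_smul, smul_smul,
        Int.units_mul_self, one_smul, hv]
      abel) (fun i j hij h1 h2 => hz i j (by lia) (by lia) (by lia))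
  exact ⟨w, fun i j h1 h2 h3 => hw i j h3 (by lia) (by lia)⟩

theorem zExactAt_of_negExactAt (hs : ∀ i, s (i + 1) = -s i) {n : ℤ} (hn : n ≤ -2)
    (h : K.NegExactAt s n) : K.ZExactAt n := by
  rintro m l hm rfl ζ hζ
  obtain ⟨z₀, rfl⟩ := K.p_surjective _ ζ
  rw [K.dz_p] at hζ
  obtain ⟨y, hy⟩ := (K.exact_p _ _).1 hζ
  -- Sweeping with target 0 completes the lift z₀ of ζ to a total cocycle with edge entry z₀.
  obtain ⟨w, hw, hsame⟩ := exists_sweep hs (upd (upd 0 n (-1) z₀) (n + 1) (-2) (-(s (n + 1) • y)))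
    0 n (n + 1) (-2 - n).toNat (by
      intro j hj i' j' hi' hj'
      obtain rfl : j = -1 := by lia
      obtain rfl : j' = -2 := by lia
      obtain rfl : i' = n := by lia
      rw [upd_self, upd_of_ne _ _ _ _ _ _ (by lia), upd_self, map_neg, map_units_smul, smul_neg,
        smul_smul, Int.units_mul_self, one_smul, hy]
      exact add_neg_cancel _) (fun _ _ _ _ _ => TotEq.zero _ _ _)
  obtain ⟨v, hv⟩ := h w fun i j h1 h2 h3 => hw i j h3 (by lia) (by lia)
  have := hv n (-1) (by lia) le_rfl (by lia) m (-2) hm rfl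
  rw [hsame _ _ (by lia), upd_of_ne _ _ _ _ _ _ (by lia), upd_self] at this
  refine ⟨K.p m (v m (-1)), ?_⟩
  rw [K.dz_p, ← this, map_add, map_units_smul, (K.exact_p _).apply_apply_eq_zero, smul_zero,
    add_zero]

theorem posExactAt_of_zExactAt (hs : ∀ i, s (i + 1) = -s i) {n : ℤ} (hn : 1 ≤ n)
    (h : K.ZExactAt n) : K.PosExactAt s n := by
  intro z hsupp hz
  -- Starting from zero in column -1, the sweep stops at column n - 1; only the equation at (n, 0)
  -- remains, since solving it by `dv` would need an entry outside the quadrant.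
  obtain ⟨w, hw, hsame⟩ := exists_sweep hs 0 z n (-1) n.toNat (by
      intro j hj i' j' hi' hj'
      simp [hsupp (-1) j (by lia)]) (fun i j hij h1 h2 => hz i j (by lia) (by lia) hij)
  have hcl := dv_sub_dh_eq_zero hs (show n - 1 + 1 = n by lia) (show (0 : ℤ) + 1 = 1 by lia)
    (hw (n - 1) 1 (by lia) (by lia) (by lia)) (hz n 1 (by lia) (by lia) (by lia))
  obtain ⟨ζ, hζ⟩ := (K.exact_q _ _).1 hcl
  have hdζ : K.dz n (n + 1) ζ = 0 := by
    apply K.q_injective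
    have := hz (n + 1) 0 (by lia) le_rfl (by lia) n (-1) rfl rfl
    rw [hsupp (n + 1) (-1) (by lia), map_zero, smul_zero, add_zero] at this
    rw [K.q_dz, hζ, map_sub, K.dh_dh, this, map_zero]
    simp
  obtain ⟨ξ, hξ⟩ := h (n - 1) (n + 1) (by lia) rfl ζ hdζ
  -- The correction `q ξ` repairs the equation at (n, 0) and, being killed by `dv`, leaves the one
  -- at (n - 1, 1) intact.
  refine ⟨upd w (n - 1) 0 (w (n - 1) 0 + K.q _ ξ), fun i j h1 h2 => ?_, fun i j hi hj hij => ?_⟩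
  · rw [upd_of_ne _ _ _ _ _ _ (by lia), hsame _ _ (by lia)]
    rfl
  · rcases (by lia : i = n ∨ i = n - 1 ∨ i < n - 1) with hin | hin | hin
    · subst hin
      obtain rfl : j = 0 := by lia
      intro i' j' hi' hj'
      obtain rfl : i' = i - 1 := by lia
      rw [upd_self, upd_of_ne _ _ _ _ _ _ (by lia), hsame i j' (by lia), map_add, ← K.q_dz, hξ, hζ]
      simp
    · subst hin
      obtain rfl : j = 1 := by lia
      have hw' := hw (n - 1) 1 (by lia) (by lia) (by lia)
      intro i' j' hi' hj'
      obtain rfl : j' = 0 := by lia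
      rw [upd_self, upd_of_ne _ _ _ _ _ _ (by lia), map_add, (K.exact_q _).apply_apply_eq_zero,
        add_zero]
      exact hw' i' 0 hi' hj'
    · exact (hw i j hij (by lia) (by lia)).congr (fun _ _ => upd_of_ne _ _ _ _ _ _ (by lia))
        (fun _ _ => upd_of_ne _ _ _ _ _ _ (by lia)) rfl

theorem zExactAt_of_posExactAt (hs : ∀ i, s (i + 1) = -s i) {n : ℤ} (hn : 1 ≤ n)
    (h : K.PosExactAt s n) : K.ZExactAt n := by
  rintro m l hm rfl ζ hζ
  obtain ⟨z, hz⟩ : ∃ z : ∀ i j, K.B i j, z = upd 0 n 0 (K.q n ζ) := ⟨_, rfl⟩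
  have hz₀ : z n 0 = K.q n ζ := by rw [hz, upd_self]
  have hz₁ (i j : ℤ) (hij : i ≠ n ∨ j ≠ 0) : z i j = 0 := by
    rw [hz, upd_of_ne _ _ _ _ _ _ hij]; rfl
  obtain ⟨w, hsupp, hw⟩ := h z (fun i j hij => hz₁ i j (by lia)) (by
    intro i j hi hj hij i' j' hi' hj'
    rcases (by lia : (i' = n ∧ j = 0) ∨ (i = n ∧ j' = 0) ∨ (i ≠ n ∧ j ≠ 0 ∧ i' ≠ n)) with
      ⟨h1, h2⟩ | ⟨h1, h2⟩ | ⟨h1, h2, h3⟩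
    · subst h1 h2
      rw [hz₀, hz₁ _ _ (by lia), ← K.q_dz, hi'.symm, hζ]
      simp
    · subst h1 h2
      obtain rfl : j = 1 := by lia
      rw [hz₀, hz₁ _ _ (by lia), (K.exact_q _).apply_apply_eq_zero]
      simp
    · rw [hz₁ _ _ (by lia), hz₁ _ _ (by lia)]
      simp)
  -- Off the corner (n, 0) the family w satisfies the cocycle equations. Subtracting a coboundary
  -- makes its entry at (n - 1, 0) a `dv`-cocycle, hence of the form `q ξ`, without changing its
  -- image under `dh`.
  obtain ⟨v, hv, hsame⟩ := exists_sweep hs 0 w (n - 1) (-1) (n - 1).toNat (by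
      intro j hj i' j' hi' hj'
      simp [hsupp (-1) j (by lia) (by lia)])
    (fun i j hij h1 h2 => (hw i j (by lia) (by lia) (by lia)).congr (fun _ _ => rfl)
      (fun _ _ => rfl) (hz₁ _ _ (by lia)).symm)
  obtain rfl : m = n - 1 := by lia
  have hcl := dv_sub_dh_eq_zero hs (show n - 2 + 1 = n - 1 by lia) (show (0 : ℤ) + 1 = 1 by lia)
    (hv (n - 2) 1 (by lia) (by lia) (by lia))
    ((hw (n - 1) 1 (by lia) (by lia) (by lia)).congr (fun _ _ => rfl)
      (fun _ _ => rfl) (hz₁ _ _ (by lia)).symm)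
  obtain ⟨ξ, hξ⟩ := (K.exact_q _ _).1 hcl
  refine ⟨ξ, K.q_injective _ ?_⟩
  have := hw n 0 (by lia) le_rfl (by lia) (n - 1) (-1) hm rfl
  rw [hsupp n (-1) (by lia) (by lia), map_zero, smul_zero, add_zero] at this
  rw [K.q_dz, hξ, map_sub, K.dh_dh, sub_zero, this, hz₀]

/-- The gluing map `dh ∘ dv` from (-1, -1) to (0, 0) is `q ∘ dz ∘ p`, with p surjective and q
injective. -/
theorem zExactAt_zero_iff : K.ZExactAt 0 ↔
    ∀ z : K.B 0 0, K.dh 0 1 0 z = 0 → K.dv 0 0 1 z = 0 →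
      ∃ w : K.B (-1) (-1), K.dh (-1) 0 0 (K.dv (-1) (-1) 0 w) = z := by
  constructor
  · intro h z hh hv
    obtain ⟨ζ, rfl⟩ := (K.exact_q _ _).1 hv
    obtain ⟨ξ, hξ⟩ := h (-1) 1 rfl rfl ζ (K.q_injective _ (by rw [K.q_dz, hh, map_zero]))
    obtain ⟨w, rfl⟩ := K.p_surjective _ ξ
    exact ⟨w, by rw [← K.q_p, ← K.q_dz, hξ]⟩
  · rintro h m l hm rfl ζ hζ
    obtain rfl : m = -1 := by lia
    obtain ⟨w, hw⟩ := h (K.q 0 ζ) ((K.q_dz 0 1 ζ).symm.trans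
      ((congrArg _ hζ).trans (map_zero _))) ((K.exact_q _).apply_apply_eq_zero _)
    refine ⟨K.p _ w, K.q_injective _ ?_⟩
    rw [K.q_dz, K.q_p, hw]

theorem zExactAt_neg_one_iff (s : ℤ → ℤˣ) : K.ZExactAt (-1) ↔
    ∀ z : K.B (-1) (-1), K.dh (-1) 0 0 (K.dv (-1) (-1) 0 z) = 0 →
      ∃ (w : K.B (-2) (-1)) (w' : K.B (-1) (-2)),
        K.dh (-2) (-1) (-1) w + s (-1) • K.dv (-1) (-2) (-1) w' = z := by
  constructor
  · intro h z hz
    obtain ⟨ξ, hξ⟩ := h (-2) 0 rfl rfl (K.p _ z) (K.q_injective _ (by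
      rw [K.q_dz, K.q_p, hz, map_zero]))
    obtain ⟨w, rfl⟩ := K.p_surjective _ ξ
    rw [K.dz_p, eq_comm, ← sub_eq_zero, ← map_sub] at hξ
    obtain ⟨v, hv⟩ := (K.exact_p _ _).1 hξ
    refine ⟨w, s (-1) • v, ?_⟩
    rw [map_units_smul, smul_smul, Int.units_mul_self, one_smul, hv]
    abel
  · rintro h m l hm hl ζ hζ
    obtain rfl : m = -2 := by lia
    obtain rfl : l = 0 := by lia
    obtain ⟨z, rfl⟩ := K.p_surjective _ ζ
    obtain ⟨w, w', hw⟩ := h z (by rw [← K.q_p, ← K.q_dz, hζ, map_zero])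
    refine ⟨K.p _ w, ?_⟩
    rw [K.dz_p, ← hw, map_add, map_units_smul, (K.exact_p _).apply_apply_eq_zero, smul_zero,
      add_zero]

end ResolvedBicomplex

/-! ### The bicomplex of maps out of the pinched tensor product -/

section CompRight

variable {P X Y W : Type u} [AddCommGroup P] [Module R P] [AddCommGroup X] [Module R X]
  [AddCommGroup Y] [Module R Y] [AddCommGroup W] [Module R W]

theorem compRight_surjective [Module.Projective R P] (f : X →ₗ[R] Y) (hf : Function.Surjective f) :
    Function.Surjective (LinearMap.compRight R f : (P →ₗ[R] X) →ₗ[R] (P →ₗ[R] Y)) :=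
  fun φ => Module.projective_lifting_property f φ hf

theorem compRight_injective (f : X →ₗ[R] Y) (hf : Function.Injective f) :
    Function.Injective (LinearMap.compRight R f : (P →ₗ[R] X) →ₗ[R] (P →ₗ[R] Y)) :=
  fun _ _ h => LinearMap.ext fun x => hf (LinearMap.congr_fun h x)

theorem compRight_exact [Module.Projective R P] (f : X →ₗ[R] Y) (g : Y →ₗ[R] W)
    (h : Function.Exact f g) :
    Function.Exact (LinearMap.compRight R f : (P →ₗ[R] X) →ₗ[R] (P →ₗ[R] Y))
      (LinearMap.compRight R g : (P →ₗ[R] Y) →ₗ[R] (P →ₗ[R] W)) := by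
  intro φ
  constructor
  · intro hφ
    have hmem (x : P) : φ x ∈ LinearMap.range f := (h _).1 (LinearMap.congr_fun hφ x)
    obtain ⟨ψ, hψ⟩ := Module.projective_lifting_property f.rangeRestrict
      (φ.codRestrict _ hmem) f.surjective_rangeRestrict
    exact ⟨ψ, LinearMap.ext fun x => congrArg Subtype.val (LinearMap.congr_fun hψ x)⟩
  · rintro ⟨ψ, rfl⟩
    exact LinearMap.ext fun x => h.apply_apply_eq_zero (ψ x)

end CompRight

/-- A factorization of `d : A₀ → A₋₁` through the cokernel `N` of `d : A₁ → A₀`. -/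
structure CokernelFactorization (A : ChainComplex (ModuleCat.{u} R) ℤ) (N : Type u)
    [AddCommGroup N] [Module R N] where
  π : A.X 0 →ₗ[R] N
  ι : N →ₗ[R] A.X (-1)
  surjective : Function.Surjective π
  exact : Function.Exact (A.d 1 0).hom π
  ι_comp_π : ι ∘ₗ π = (A.d 0 (-1)).hom

theorem IsCompleteResolution.nonempty_cokernelFactorization
    {A : ChainComplex (ModuleCat.{u} R) ℤ} {N : Type u} [AddCommGroup N] [Module R N]
    (h : IsCompleteResolution A N) : Nonempty (CokernelFactorization A N) := by
  obtain ⟨e⟩ := h.coker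
  have hle : LinearMap.range (A.d 1 0).hom ≤ LinearMap.ker (A.d 0 (-1)).hom := by
    rintro _ ⟨x, rfl⟩
    exact d_d_apply A _ _ _ x
  refine ⟨⟨e.toLinearMap ∘ₗ Submodule.mkQ _, Submodule.liftQ _ _ hle ∘ₗ e.symm.toLinearMap,
    e.surjective.comp (Submodule.mkQ_surjective _), ?_, ?_⟩⟩
  · rw [LinearMap.exact_iff, LinearEquiv.ker_comp, Submodule.ker_mkQ]
  · ext x
    simp

section Bicomplex

variable {T A : ChainComplex (ModuleCat.{u} R) ℤ} {N Q : Type u} [AddCommGroup N] [Module R N]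
  [AddCommGroup Q] [Module R Q]

/-- The bicomplex `Hom(Tᵢ, Hom(Aⱼ, Q))`. -/
def homBicomplex (hT : ∀ n, Module.Projective R (T.X n)) (F : CokernelFactorization A N)
    (hA : ∀ n, HomExactAt A Q n) : ResolvedBicomplex R where
  B i j := T.X i →ₗ[R] A.X j →ₗ[R] Q
  Z i := T.X i →ₗ[R] N →ₗ[R] Q
  dh i i' j := LinearMap.lcomp R _ (T.d i' i).hom
  dv i j j' := LinearMap.compRight R (LinearMap.lcomp R Q (A.d j' j).hom)
  dz i i' := LinearMap.lcomp R _ (T.d i' i).hom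
  p i := LinearMap.compRight R (LinearMap.lcomp R Q F.ι)
  q i := LinearMap.compRight R (LinearMap.lcomp R Q F.π)
  dh_dh i i' i'' j φ := by
    ext x y
    simp [d_d_apply]
  dh_dv i i' j j' φ := rfl
  exact_dv i j j' j'' hj hj' := by
    have := hT i
    refine compRight_exact _ _ fun φ => ⟨fun h => hA j' j'' j hj' hj φ h, ?_⟩
    rintro ⟨ψ, rfl⟩
    ext x
    simp [d_d_apply]
  p_surjective i := by
    have := hT i
    refine compRight_surjective _ fun φ => ?_
    -- Exactness of Hom(A, Q) in degree 0 extends maps from N along ι, so injectivity of ι itself is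
    -- never required.
    obtain ⟨ψ, hψ⟩ := hA 0 1 (-1) rfl rfl (φ ∘ₗ F.π) (LinearMap.ext fun x => by
      simp [F.exact.apply_apply_eq_zero])
    refine ⟨ψ, LinearMap.ext fun y => ?_⟩
    obtain ⟨x, rfl⟩ := F.surjective y
    rw [← F.ι_comp_π] at hψ
    exact LinearMap.congr_fun hψ x
  exact_p i := by
    have := hT i
    refine compRight_exact _ _ fun φ => ⟨fun h => hA (-1) 0 (-2) rfl rfl φ ?_, ?_⟩
    · rw [← F.ι_comp_π, ← LinearMap.comp_assoc]
      exact (congrArg (· ∘ₗ F.π) h).trans (LinearMap.zero_comp _)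
    · rintro ⟨ψ, rfl⟩
      refine LinearMap.ext fun y => ?_
      obtain ⟨x, rfl⟩ := F.surjective y
      have : F.ι (F.π x) = (A.d 0 (-1)).hom x := LinearMap.congr_fun F.ι_comp_π x
      simp [this, d_d_apply]
  q_injective i := compRight_injective _ fun φ ψ h => LinearMap.ext fun y => by
    obtain ⟨x, rfl⟩ := F.surjective y
    exact LinearMap.congr_fun h x
  exact_q i := by
    have := hT i
    refine compRight_exact _ _ fun φ => ⟨fun h => ?_, ?_⟩
    · obtain ⟨ψ, hψ⟩ := exists_desc_of_exact F.surjective F.exact φ (LinearMap.congr_fun h)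
      exact ⟨ψ, LinearMap.ext hψ⟩
    · rintro ⟨ψ, rfl⟩
      ext x
      simp [F.exact.apply_apply_eq_zero]
  q_p i φ := by
    ext x y
    exact congrArg (φ x) (LinearMap.congr_fun F.ι_comp_π y)
  dz_p i i' φ := rfl
  q_dz i i' φ := rfl

variable (hT : ∀ n, Module.Projective R (T.X n)) (F : CokernelFactorization A N)
  (hA : ∀ n, HomExactAt A Q n)

theorem homBicomplex_zExactAt_iff (n : ℤ) :
    (homBicomplex hT F hA).ZExactAt n ↔ HomExactAt T (N →ₗ[R] Q) n :=
  ⟨fun h m l hm hl => h l m hl hm, fun h m l hm hl => h l m hl hm⟩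

/-- The components of a linear map on the pinched tensor product in degree `n`. -/
def components {n : ℤ} (φ : PinchedX T A n →ₗ[R] Q) (i j : ℤ) : (homBicomplex hT F hA).B i j :=
  TensorProduct.curry (φ ∘ₗ pinchedIncl T A n i j)

variable {hT F hA}

theorem components_of_notMem {n : ℤ} (φ : PinchedX T A n →ₗ[R] Q) {i j : ℤ}
    (h : (i, j) ∉ pinchedIndex n) : components hT F hA φ i j = 0 := by
  rw [components, pinchedIncl_of_notMem T A n i j h, LinearMap.comp_zero]
  rfl

theorem eq_of_components_eq {n : ℤ} {φ ψ : PinchedX T A n →ₗ[R] Q}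
    (h : ∀ i j, (i, j) ∈ pinchedIndex n → components hT F hA φ i j = components hT F hA ψ i j) :
    φ = ψ := by
  apply DirectSum.linearMap_ext
  rintro ⟨⟨i, j⟩, hij⟩
  apply TensorProduct.ext'
  intro x y
  have := LinearMap.congr_fun (LinearMap.congr_fun (h i j hij) x) y
  have e (χ : PinchedX T A n →ₗ[R] Q) :
      TensorProduct.curry (χ ∘ₗ pinchedIncl T A n i j) x y =
      χ (DirectSum.lof R (pinchedIndex n) (fun p => T.X p.1.1 ⊗[R] A.X p.1.2) ⟨(i, j), hij⟩
        (x ⊗ₜ[R] y)) := by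
    change χ (pinchedIncl T A n i j (x ⊗ₜ[R] y)) = _
    simp [pinchedIncl, hij]
  exact (e φ).symm.trans (this.trans (e ψ))

theorem exists_components_eq (n : ℤ) (w : ∀ i j, (homBicomplex hT F hA).B i j) :
    ∃ φ : PinchedX T A n →ₗ[R] Q,
      ∀ i j, (i, j) ∈ pinchedIndex n → components hT F hA φ i j = w i j := by
  refine ⟨DirectSum.toModule R _ Q fun p => TensorProduct.lift (w p.1.1 p.1.2), fun i j hij => ?_⟩
  refine LinearMap.ext fun x => LinearMap.ext fun y => ?_
  change DirectSum.toModule R _ Q _ (pinchedIncl T A n i j (x ⊗ₜ[R] y)) = _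
  simp only [pinchedIncl, hij, dif_pos]
  erw [DirectSum.toModule_lof]
  exact TensorProduct.lift.tmul x y

theorem totEq_components_of_pos {n m : ℤ} (hm : m + 1 = n) (hn : 1 ≤ n)
    (φ : PinchedX T A m →ₗ[R] Q) {i j : ℤ} (hij : (i, j) ∈ pinchedIndex n) :
    ResolvedBicomplex.TotEq Int.negOnePow (components hT F hA φ)
      (components hT F hA (φ ∘ₗ pinchedD T A n m)) i j := by
  intro i' j' hi hj
  obtain rfl : i' = i - 1 := by lia
  obtain rfl : j' = j - 1 := by lia
  refine LinearMap.ext fun x => LinearMap.ext fun y => ?_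
  change φ (pinchedIncl T A m (i - 1) j ((T.d i (i - 1)).hom x ⊗ₜ[R] y)) + i.negOnePow •
    φ (pinchedIncl T A m i (j - 1) (x ⊗ₜ[R] (A.d j (j - 1)).hom y)) =
    φ (pinchedD T A n m (pinchedIncl T A n i j (x ⊗ₜ[R] y)))
  rw [pinchedD_incl T A n m i j hm hij, pinchedComponent, if_pos hn]
  simp [Units.smul_def]

theorem totEq_components_of_neg {n m : ℤ} (hm : m + 1 = n) (hn : n ≤ -1)
    (φ : PinchedX T A m →ₗ[R] Q) {i j : ℤ} (hij : (i, j) ∈ pinchedIndex n) :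
    ResolvedBicomplex.TotEq (fun i => -i.negOnePow) (components hT F hA φ)
      (components hT F hA (φ ∘ₗ pinchedD T A n m)) i j := by
  intro i' j' hi hj
  obtain rfl : i' = i - 1 := by lia
  obtain rfl : j' = j - 1 := by lia
  refine LinearMap.ext fun x => LinearMap.ext fun y => ?_
  change φ (pinchedIncl T A m (i - 1) j ((T.d i (i - 1)).hom x ⊗ₜ[R] y)) + (-i.negOnePow) •
    φ (pinchedIncl T A m i (j - 1) (x ⊗ₜ[R] (A.d j (j - 1)).hom y)) =
    φ (pinchedD T A n m (pinchedIncl T A n i j (x ⊗ₜ[R] y)))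
  rw [pinchedD_incl T A n m i j hm hij, pinchedComponent, if_neg (by lia), if_neg (by lia)]
  simp [Units.smul_def, sub_eq_add_neg]

theorem components_comp_zero (φ : PinchedX T A (-1) →ₗ[R] Q) :
    components hT F hA (φ ∘ₗ pinchedD T A 0 (-1)) 0 0 =
      (homBicomplex hT F hA).dh (-1) 0 0 ((homBicomplex hT F hA).dv (-1) (-1) 0
        (components hT F hA φ (-1) (-1))) := by
  refine LinearMap.ext fun x => LinearMap.ext fun y => ?_
  change φ (pinchedD T A 0 (-1) (pinchedIncl T A 0 0 0 (x ⊗ₜ[R] y))) =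
    φ (pinchedIncl T A (-1) (-1) (-1) ((T.d 0 (-1)).hom x ⊗ₜ[R] (A.d 0 (-1)).hom y))
  rw [pinchedD_incl T A 0 (-1) 0 0 rfl (by simp [pinchedIndex]), pinchedComponent,
    if_neg (by lia), if_pos rfl]
  rfl

end Bicomplex

/-! ### Exactness of Hom(T ⊠ A, Q) in terms of Hom(T, Hom(N, Q)) -/

section HomPinched

variable {T A : ChainComplex (ModuleCat.{u} R) ℤ} {N Q : Type u} [AddCommGroup N] [Module R N]
  [AddCommGroup Q] [Module R Q]

open ResolvedBicomplex

theorem ResolvedBicomplex.TotEq.unique {K : ResolvedBicomplex R} {s : ℤ → ℤˣ}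
    {w z z' : ∀ i j, K.B i j} {i j : ℤ} (h : TotEq s w z i j) (h' : TotEq s w z' i j) :
    z i j = z' i j :=
  (h (i - 1) (j - 1) (by lia) (by lia)).symm.trans (h' (i - 1) (j - 1) (by lia) (by lia))

theorem mem_pinchedIndex {n i j : ℤ} : (i, j) ∈ pinchedIndex n ↔
    (0 ≤ n ∧ 0 ≤ i ∧ 0 ≤ j ∧ i + j = n) ∨ (n ≤ -1 ∧ i ≤ -1 ∧ j ≤ -1 ∧ i + (j + 1) = n) :=
  Iff.rfl

theorem homExactAt_pinchedTensor_iff (n : ℤ) :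
    HomExactAt (pinchedTensor T A) Q n ↔ ∀ φ : PinchedX T A n →ₗ[R] Q,
      φ ∘ₗ pinchedD T A (n + 1) n = 0 →
        ∃ ψ : PinchedX T A (n - 1) →ₗ[R] Q, ψ ∘ₗ pinchedD T A n (n - 1) = φ := by
  constructor
  · exact fun h φ hφ => h (n + 1) (n - 1) rfl (by lia) φ hφ
  · rintro h m l rfl hl φ hφ
    obtain rfl : l = n - 1 := by lia
    exact h φ hφ

variable (hT : ∀ n, Module.Projective R (T.X n)) (F : CokernelFactorization A N)
  (hA : ∀ n, HomExactAt A Q n)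

theorem homExactAt_pinchedTensor_iff_posExactAt {n : ℤ} (hn : 1 ≤ n) :
    HomExactAt (pinchedTensor T A) Q n ↔
      (homBicomplex hT F hA).PosExactAt Int.negOnePow n := by
  rw [homExactAt_pinchedTensor_iff]
  constructor
  · intro h z hz₀ hz
    obtain ⟨φ, hφ⟩ := exists_components_eq (hT := hT) (F := F) (hA := hA) n z
    have hφ' (i j : ℤ) (hij : i + j = n) : components hT F hA φ i j = z i j := by
      by_cases hmem : (i, j) ∈ pinchedIndex n
      · exact hφ i j hmem
      · rw [components_of_notMem _ hmem, hz₀]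
        rw [mem_pinchedIndex] at hmem
        lia
    obtain ⟨ψ, hψ⟩ := h φ (eq_of_components_eq (hT := hT) (F := F) (hA := hA) fun i j hij => by
      refine (totEq_components_of_pos rfl (by lia) φ hij).unique ?_
      rw [mem_pinchedIndex] at hij
      exact (hz i j (by lia) (by lia) (by lia)).congr (fun _ _ => hφ' _ _ (by lia))
        (fun _ _ => hφ' _ _ (by lia)) rfl)
    refine ⟨components hT F hA ψ, fun i j h1 h2 => components_of_notMem _ ?_,
      fun i j hi hj hij => ?_⟩
    · rw [mem_pinchedIndex]
      lia
    · have := totEq_components_of_pos (hT := hT) (F := F) (hA := hA) (by lia) hn ψ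
        (mem_pinchedIndex.2 (Or.inl ⟨by lia, hi, hj, hij⟩))
      rw [hψ] at this
      exact this.congr (fun _ _ => rfl) (fun _ _ => rfl) (hφ' i j hij).symm
  · intro h φ hφ
    obtain ⟨w, hw₀, hw⟩ := h (components hT F hA φ)
      (fun i j hij => components_of_notMem _ (by rw [mem_pinchedIndex]; lia))
      (fun i j hi hj hij => by
        have := totEq_components_of_pos (hT := hT) (F := F) (hA := hA) rfl
          (show 1 ≤ n + 1 by lia) φ (mem_pinchedIndex.2 (Or.inl ⟨by lia, hi, hj, hij⟩))
        rwa [hφ] at this)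
    obtain ⟨ψ, hψ⟩ := exists_components_eq (hT := hT) (F := F) (hA := hA) (n - 1) w
    have hψ' (i j : ℤ) (hij : i + j = n - 1) : components hT F hA ψ i j = w i j := by
      by_cases hmem : (i, j) ∈ pinchedIndex (n - 1)
      · exact hψ i j hmem
      · rw [components_of_notMem _ hmem, hw₀ _ _ _ hij]
        rw [mem_pinchedIndex] at hmem
        lia
    refine ⟨ψ, eq_of_components_eq (hT := hT) (F := F) (hA := hA) fun i j hij => ?_⟩
    refine (totEq_components_of_pos (by lia) hn ψ hij).unique ?_
    rw [mem_pinchedIndex] at hij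
    exact (hw i j (by lia) (by lia) (by lia)).congr (fun _ _ => hψ' _ _ (by lia))
      (fun _ _ => hψ' _ _ (by lia)) rfl

theorem homExactAt_pinchedTensor_iff_negExactAt {n : ℤ} (hn : n ≤ -2) :
    HomExactAt (pinchedTensor T A) Q n ↔
      (homBicomplex hT F hA).NegExactAt (fun i => -i.negOnePow) n := by
  rw [homExactAt_pinchedTensor_iff]
  constructor
  · intro h z hz
    obtain ⟨φ, hφ⟩ := exists_components_eq (hT := hT) (F := F) (hA := hA) n z
    obtain ⟨ψ, hψ⟩ := h φ (eq_of_components_eq (hT := hT) (F := F) (hA := hA) fun i j hij => by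
      refine (totEq_components_of_neg rfl (by lia) φ hij).unique ?_
      rw [mem_pinchedIndex] at hij
      exact (hz i j (by lia) (by lia) (by lia)).congr
        (fun _ _ => hφ _ _ (by rw [mem_pinchedIndex]; lia))
        (fun _ _ => hφ _ _ (by rw [mem_pinchedIndex]; lia)) rfl)
    refine ⟨components hT F hA ψ, fun i j hi hj hij => ?_⟩
    have hmem : (i, j) ∈ pinchedIndex n := by rw [mem_pinchedIndex]; lia
    have := totEq_components_of_neg (hT := hT) (F := F) (hA := hA) (by lia)
      (show n ≤ -1 by lia) ψ hmem
    rw [hψ] at this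
    exact this.congr (fun _ _ => rfl) (fun _ _ => rfl) (hφ i j hmem).symm
  · intro h φ hφ
    obtain ⟨w, hw⟩ := h (components hT F hA φ) (fun i j hi hj hij => by
      have := totEq_components_of_neg (hT := hT) (F := F) (hA := hA) (i := i) (j := j) rfl
        (show n + 1 ≤ -1 by lia) φ (by rw [mem_pinchedIndex]; lia)
      rwa [hφ] at this)
    obtain ⟨ψ, hψ⟩ := exists_components_eq (hT := hT) (F := F) (hA := hA) (n - 1) w
    refine ⟨ψ, eq_of_components_eq (hT := hT) (F := F) (hA := hA) fun i j hij => ?_⟩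
    refine (totEq_components_of_neg (by lia) (by lia) ψ hij).unique ?_
    rw [mem_pinchedIndex] at hij
    exact (hw i j (by lia) (by lia) (by lia)).congr
      (fun _ _ => hψ _ _ (by rw [mem_pinchedIndex]; lia))
      (fun _ _ => hψ _ _ (by rw [mem_pinchedIndex]; lia)) rfl

theorem homExactAt_pinchedTensor_zero_iff :
    HomExactAt (pinchedTensor T A) Q 0 ↔ (homBicomplex hT F hA).ZExactAt 0 := by
  rw [zExactAt_zero_iff, homExactAt_pinchedTensor_iff]
  have mem_zero : ((0 : ℤ), (0 : ℤ)) ∈ pinchedIndex 0 := by simp [pinchedIndex]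
  have mem_neg : ((-1 : ℤ), (-1 : ℤ)) ∈ pinchedIndex (-1) := by simp [pinchedIndex]
  have hd (φ : PinchedX T A 0 →ₗ[R] Q) : φ ∘ₗ pinchedD T A 1 0 = 0 ↔
      (homBicomplex hT F hA).dh 0 1 0 (components hT F hA φ 0 0) = 0 ∧
        (homBicomplex hT F hA).dv 0 0 1 (components hT F hA φ 0 0) = 0 := by
    have h1 := totEq_components_of_pos (hT := hT) (F := F) (hA := hA) (i := 1) (j := 0)
      (zero_add 1) le_rfl φ (by simp [pinchedIndex]) 0 (-1) rfl rfl
    have h2 := totEq_components_of_pos (hT := hT) (F := F) (hA := hA) (i := 0) (j := 1)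
      (zero_add 1) le_rfl φ (by simp [pinchedIndex]) (-1) 0 rfl rfl
    rw [components_of_notMem (i := 1) (j := -1) _ (by simp [pinchedIndex]), map_zero, smul_zero,
      add_zero] at h1
    rw [components_of_notMem (i := -1) (j := 1) _ (by simp [pinchedIndex]), map_zero, zero_add,
      Int.negOnePow_zero, one_smul] at h2
    rw [h1, h2]
    refine ⟨fun h => by rw [h]; exact ⟨rfl, rfl⟩, fun h => ?_⟩
    refine eq_of_components_eq (hT := hT) (F := F) (hA := hA) fun i j hij => ?_
    rw [mem_pinchedIndex] at hij
    rcases (by lia : (i = 1 ∧ j = 0) ∨ (i = 0 ∧ j = 1)) with ⟨rfl, rfl⟩ | ⟨rfl, rfl⟩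
    · exact h.1
    · exact h.2
  have ext_zero (φ ψ : PinchedX T A 0 →ₗ[R] Q)
      (h : components hT F hA φ 0 0 = components hT F hA ψ 0 0) : φ = ψ := by
    refine eq_of_components_eq (hT := hT) (F := F) (hA := hA) fun i j hij => ?_
    rw [mem_pinchedIndex] at hij
    obtain ⟨rfl, rfl⟩ : i = 0 ∧ j = 0 := by lia
    exact h
  constructor
  · intro h z h1 h2
    obtain ⟨φ, hφ⟩ := exists_components_eq (hT := hT) (F := F) (hA := hA) 0 (upd 0 0 0 z)
    have hz := (hφ 0 0 mem_zero).trans (upd_self _ _ _ _)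
    obtain ⟨ψ, hψ⟩ := h φ ((hd φ).2 (by rw [hz]; exact ⟨h1, h2⟩))
    refine ⟨components hT F hA ψ (-1) (-1), ?_⟩
    rw [← components_comp_zero, ← hz]
    exact congrArg (components hT F hA · 0 0) hψ
  · intro h φ hφ
    obtain ⟨w, hw⟩ := h _ ((hd φ).1 hφ).1 ((hd φ).1 hφ).2
    obtain ⟨ψ, hψ⟩ := exists_components_eq (hT := hT) (F := F) (hA := hA) (-1)
      (upd 0 (-1) (-1) w)
    refine ⟨ψ, ext_zero _ _ ((components_comp_zero ψ).trans ?_)⟩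
    rw [hψ _ _ mem_neg, upd_self, hw]

theorem homExactAt_pinchedTensor_neg_one_iff :
    HomExactAt (pinchedTensor T A) Q (-1) ↔ (homBicomplex hT F hA).ZExactAt (-1) := by
  rw [zExactAt_neg_one_iff fun i => -i.negOnePow, homExactAt_pinchedTensor_iff]
  have mem_neg : ((-1 : ℤ), (-1 : ℤ)) ∈ pinchedIndex (-1) := by simp [pinchedIndex]
  have mem₁ : ((-2 : ℤ), (-1 : ℤ)) ∈ pinchedIndex (-2) := by simp [pinchedIndex]
  have mem₂ : ((-1 : ℤ), (-2 : ℤ)) ∈ pinchedIndex (-2) := by simp [pinchedIndex]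
  have hd (φ : PinchedX T A (-1) →ₗ[R] Q) : φ ∘ₗ pinchedD T A 0 (-1) = 0 ↔
      (homBicomplex hT F hA).dh (-1) 0 0 ((homBicomplex hT F hA).dv (-1) (-1) 0
        (components hT F hA φ (-1) (-1))) = 0 := by
    rw [← components_comp_zero]
    refine ⟨fun h => by rw [h]; rfl, fun h => ?_⟩
    refine eq_of_components_eq (hT := hT) (F := F) (hA := hA) fun i j hij => ?_
    rw [mem_pinchedIndex] at hij
    obtain ⟨rfl, rfl⟩ : i = 0 ∧ j = 0 := by lia
    exact h
  have htot (ψ : PinchedX T A (-2) →ₗ[R] Q) :=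
    totEq_components_of_neg (hT := hT) (F := F) (hA := hA) (by norm_num) le_rfl ψ mem_neg (-2) (-2)
      rfl rfl
  constructor
  · intro h z hz
    obtain ⟨φ, hφ⟩ := exists_components_eq (hT := hT) (F := F) (hA := hA) (-1) (upd 0 (-1) (-1) z)
    have hz' := (hφ _ _ mem_neg).trans (upd_self _ _ _ _)
    obtain ⟨ψ, hψ⟩ := h φ ((hd φ).2 (by rw [hz', hz]))
    refine ⟨_, _, (htot ψ).trans (Eq.trans ?_ hz')⟩
    exact congrArg (components hT F hA · (-1) (-1)) hψ
  · intro h φ hφ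
    obtain ⟨w, w', hw⟩ := h _ ((hd φ).1 hφ)
    obtain ⟨ψ, hψ⟩ := exists_components_eq (hT := hT) (F := F) (hA := hA) (-2)
      (upd (upd 0 (-2) (-1) w) (-1) (-2) w')
    refine ⟨ψ, eq_of_components_eq (hT := hT) (F := F) (hA := hA) fun i j hij => ?_⟩
    rw [mem_pinchedIndex] at hij
    obtain ⟨rfl, rfl⟩ : i = -1 ∧ j = -1 := by lia
    refine (htot ψ).symm.trans (Eq.trans ?_ hw)
    rw [hψ _ _ mem₁, hψ _ _ mem₂, upd_self, upd_of_ne _ _ _ _ _ _ (by lia), upd_self]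

theorem homExactAt_pinchedTensor_iff_homExactAt (hT : ∀ n, Module.Projective R (T.X n))
    (F : CokernelFactorization A N) (hA : ∀ n, HomExactAt A Q n) (n : ℤ) :
    HomExactAt (pinchedTensor T A) Q n ↔ HomExactAt T (N →ₗ[R] Q) n := by
  rw [← homBicomplex_zExactAt_iff hT F hA]
  rcases (by lia : n ≤ -2 ∨ n = -1 ∨ n = 0 ∨ 1 ≤ n) with hn | rfl | rfl | hn
  -- In negative degrees the shift of A replaces the sign (-1)^i by its negative; the sweeps need
  -- only that signs alternate.
  · have hs (i : ℤ) : -(i + 1).negOnePow = - -i.negOnePow := by rw [Int.negOnePow_succ]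
    rw [homExactAt_pinchedTensor_iff_negExactAt hT F hA hn]
    exact ⟨zExactAt_of_negExactAt hs hn, negExactAt_of_zExactAt hs hn⟩
  · exact homExactAt_pinchedTensor_neg_one_iff hT F hA
  · exact homExactAt_pinchedTensor_zero_iff hT F hA
  · rw [homExactAt_pinchedTensor_iff_posExactAt hT F hA hn]
    exact ⟨zExactAt_of_posExactAt Int.negOnePow_succ hn,
      posExactAt_of_zExactAt Int.negOnePow_succ hn⟩

end HomPinched

/-! ### The cokernel of the pinched tensor product -/

section Cokernel

variable {T A : ChainComplex (ModuleCat.{u} R) ℤ} {M N : Type u} [AddCommGroup M] [Module R M]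
  [AddCommGroup N] [Module R N]

theorem pinchedD_incl_one_zero (z : T.X 1 ⊗[R] A.X 0) :
    pinchedD T A 1 0 (pinchedIncl T A 1 1 0 z) =
      pinchedIncl T A 0 0 0 ((T.d 1 0).hom.rTensor (A.X 0) z) := by
  rw [pinchedD_incl T A 1 0 1 0 rfl (by simp [pinchedIndex]), pinchedComponent, if_pos le_rfl,
    pinchedIncl_of_notMem T A 0 1 (0 - 1) (by simp [pinchedIndex]), LinearMap.zero_comp, smul_zero,
    add_zero]
  rfl

theorem pinchedD_incl_zero_one (z : T.X 0 ⊗[R] A.X 1) :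
    pinchedD T A 1 0 (pinchedIncl T A 1 0 1 z) =
      pinchedIncl T A 0 0 0 ((A.d 1 0).hom.lTensor (T.X 0) z) := by
  rw [pinchedD_incl T A 1 0 0 1 rfl (by simp [pinchedIndex]), pinchedComponent, if_pos le_rfl,
    pinchedIncl_of_notMem T A 0 (0 - 1) 1 (by simp [pinchedIndex]), LinearMap.zero_comp, zero_add,
    Int.negOnePow_zero, one_smul]
  rfl

/-- Degree 0 has the single summand T_0 ⊗ A_0, and degree 1 only T_1 ⊗ A_0 and T_0 ⊗ A_1. By right
exactness their images together span the kernel of T_0 ⊗ A_0 → M ⊗ N. -/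
theorem nonempty_coker_pinchedTensor_equiv (F : CokernelFactorization T M)
    (G : CokernelFactorization A N) :
    Nonempty ((PinchedX T A 0 ⧸ LinearMap.range (pinchedD T A 1 0)) ≃ₗ[R] M ⊗[R] N) := by
  have mem_zero : ((0 : ℤ), (0 : ℤ)) ∈ pinchedIndex 0 := by simp [pinchedIndex]
  obtain ⟨ρ, hρ⟩ : ∃ ρ : PinchedX T A 0 →ₗ[R] T.X 0 ⊗[R] A.X 0,
      ∀ z, ρ (pinchedIncl T A 0 0 0 z) = z := by
    refine ⟨DirectSum.component R _ (fun p : pinchedIndex 0 => T.X p.1.1 ⊗[R] A.X p.1.2)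
      ⟨(0, 0), mem_zero⟩, fun z => ?_⟩
    simp only [pinchedIncl, mem_zero, dif_pos]
    exact DirectSum.component.lof_self ..
  have hρ' (x : PinchedX T A 0) : pinchedIncl T A 0 0 0 (ρ x) = x := by
    suffices h : pinchedIncl T A 0 0 0 ∘ₗ ρ = LinearMap.id from LinearMap.congr_fun h x
    apply DirectSum.linearMap_ext
    rintro ⟨⟨i, j⟩, hij⟩
    have hij' := hij
    rw [mem_pinchedIndex] at hij'
    obtain ⟨rfl, rfl⟩ : i = 0 ∧ j = 0 := by lia
    have h : DirectSum.lof R (pinchedIndex 0) (fun p => T.X p.1.1 ⊗[R] A.X p.1.2) ⟨(0, 0), hij⟩ =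
        pinchedIncl T A 0 0 0 := by
      simp [pinchedIncl, mem_zero]
    refine LinearMap.ext fun z => ?_
    change pinchedIncl T A 0 0 0 (ρ (DirectSum.lof R (pinchedIndex 0)
      (fun p => T.X p.1.1 ⊗[R] A.X p.1.2) ⟨(0, 0), hij⟩ z)) = DirectSum.lof R (pinchedIndex 0)
      (fun p => T.X p.1.1 ⊗[R] A.X p.1.2) ⟨(0, 0), hij⟩ z
    rw [h]
    exact congrArg _ (hρ z)
  have hsurj : Function.Surjective (TensorProduct.map F.π G.π ∘ₗ ρ) :=
    (TensorProduct.map_surjective F.surjective G.surjective).comp fun z => ⟨_, hρ z⟩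
  have hker := TensorProduct.map_ker F.exact F.surjective G.exact G.surjective
  have hrange : LinearMap.range (pinchedD T A 1 0) =
      LinearMap.ker (TensorProduct.map F.π G.π ∘ₗ ρ) := by
    apply le_antisymm
    · rw [LinearMap.range_le_ker_iff]
      apply DirectSum.linearMap_ext
      rintro ⟨⟨i, j⟩, hij⟩
      have h : DirectSum.lof R (pinchedIndex 1) (fun p => T.X p.1.1 ⊗[R] A.X p.1.2) ⟨(i, j), hij⟩ =
          pinchedIncl T A 1 i j := by
        simp [pinchedIncl, hij]
      rw [mem_pinchedIndex] at hij
      refine LinearMap.ext fun z => ?_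
      change TensorProduct.map F.π G.π (ρ (pinchedD T A 1 0 (DirectSum.lof R (pinchedIndex 1)
        (fun p => T.X p.1.1 ⊗[R] A.X p.1.2) ⟨(i, j), hij⟩ z))) = 0
      rw [h, ← LinearMap.mem_ker, hker]
      rcases (by lia : (i = 1 ∧ j = 0) ∨ (i = 0 ∧ j = 1)) with ⟨rfl, rfl⟩ | ⟨rfl, rfl⟩
      · erw [pinchedD_incl_one_zero, hρ]
        exact Submodule.mem_sup_right ⟨_, rfl⟩
      · erw [pinchedD_incl_zero_one, hρ]
        exact Submodule.mem_sup_left ⟨_, rfl⟩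
    · intro x hx
      rw [LinearMap.ker_comp, Submodule.mem_comap, hker] at hx
      obtain ⟨_, ⟨a, rfl⟩, _, ⟨b, rfl⟩, hab⟩ := Submodule.mem_sup.1 hx
      refine ⟨pinchedIncl T A 1 0 1 a + pinchedIncl T A 1 1 0 b, ?_⟩
      rw [map_add, pinchedD_incl_zero_one, pinchedD_incl_one_zero, ← map_add, hab, hρ']
  exact ⟨(Submodule.quotEquivOfEq _ _ hrange).trans (LinearMap.quotKerEquivOfSurjective _ hsurj)⟩

end Cokernel

end PinchedTensor

end

/-! ### The main theorem -/

theorem mainTheorem6 {R : Type u} [CommRing R]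
    (M N : Type u) [AddCommGroup M] [Module R M] [AddCommGroup N] [Module R N]
    (T T' : ChainComplex (ModuleCat.{u} R) ℤ)
    (hT : PinchedTensor.IsCompleteResolution T M) (hT' : PinchedTensor.IsCompleteResolution T' N)
    (S : ChainComplex (ModuleCat.{u} R) ℤ) (hS : PinchedTensor.IsCompleteResolution S M)
    (hTor : ∀ i : ℤ, Limits.IsZero (PinchedTensor.tateTor S N i)) :
    (∀ n : ℤ, Module.Projective R ((PinchedTensor.pinchedTensor T T').X n)) ∧
    (PinchedTensor.pinchedTensor T T').Acyclic ∧
    (PinchedTensor.IsTotallyAcyclic (PinchedTensor.pinchedTensor T T') ↔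
      ∀ (Q : Type u) [AddCommGroup Q] [Module R Q], Module.Projective R Q →
        ∀ i : ℤ, Limits.IsZero (PinchedTensor.tateExt S (N →ₗ[R] Q) i)) ∧
    (PinchedTensor.IsTotallyAcyclic (PinchedTensor.pinchedTensor T T') →
      PinchedTensor.IsGorensteinProjective R (M ⊗[R] N) ∧
      PinchedTensor.IsCompleteResolution (PinchedTensor.pinchedTensor T T') (M ⊗[R] N)) := by
  open PinchedTensor in
  have pT := hT.totallyAcyclic.projective
  have pT' := hT'.totallyAcyclic.projective
  obtain ⟨F⟩ := hT.nonempty_cokernelFactorization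
  obtain ⟨F'⟩ := hT'.nonempty_cokernelFactorization
  have proj (n : ℤ) : Module.Projective R ((pinchedTensor T T').X n) :=
    inferInstanceAs (Module.Projective R (PinchedX T T' n))
  have acyclic : (pinchedTensor T T').Acyclic := by
    rw [acyclic_iff_homExactAt_characterModule]
    intro n
    rw [homExactAt_pinchedTensor_iff_homExactAt pT F'
      ((acyclic_iff_homExactAt_characterModule _).1 hT'.totallyAcyclic.acyclic)]
    -- The Tor hypothesis concerns S, whereas the pinched complex is built from T.
    refine hS.homExactAt_of_homExactAt hT _ n ?_
    rw [← homExactAt_tensorModule_iff]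
    exact (acyclic_iff_homExactAt_characterModule _).1 ((isZero_tateTor_iff S N).1 hTor) n
  refine ⟨proj, acyclic, ⟨fun h Q _ _ hQ => ?_, fun h => ⟨proj, acyclic, fun Q _ _ hQ => ?_⟩⟩,
    fun h => ?_⟩
  · rw [isZero_tateExt_iff]
    intro n
    refine hT.homExactAt_of_homExactAt hS _ n ?_
    rw [← homExactAt_pinchedTensor_iff_homExactAt pT F' (hT'.totallyAcyclic.homExactAt Q)]
    exact h.homExactAt Q n
  · rw [homModule_acyclic_iff]
    intro n
    rw [homExactAt_pinchedTensor_iff_homExactAt pT F' (hT'.totallyAcyclic.homExactAt Q)]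
    exact hS.homExactAt_of_homExactAt hT _ n ((isZero_tateExt_iff _ _).1 (h Q hQ) n)
  · have res : IsCompleteResolution (pinchedTensor T T') (M ⊗[R] N) :=
      ⟨h, nonempty_coker_pinchedTensor_equiv F F'⟩
    exact ⟨⟨_, res⟩, res⟩
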